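/- Let $d\in\mathbb N=\{1,2,\dots\}$. For $n=1,\dots,d$ let $F^{(n)},G^{(n)}$ be separable real Hilbert spaces, $S^{(n)}:F^{(n)}\to G^{(n)}$ a bounded linear operator, $(\Omega^{(n)},\Sigma^{(n)},\mathbb P^{(n)})$ a probability space and $\Lambda^{(n)}$ a set of bounded linear functionals on $F^{(n)}$. Let $F_d=\bigotimes_n F^{(n)}$, $G_d=\bigotimes_n G^{(n)}$ be the Hilbert space tensor products, $S_d=\bigotimes_n S^{(n)}$, and $(\Omega,\Sigma,\mathbb P)$ the product of the spaces $(\Omega^{(n)},\Sigma^{(n)},\mathbb P^{(n)})$. For a random bounded linear operator $A$ (a map $\omega\mapsto A(\omega)$ with $\omega\mapsto A(\omega)f$ measurable for every $f$) approximating $S$, put $$e^{\rm r}(S,A)=\sup_{\|f\|\le1}\mathbb E\big[\|(S-A)f\|^2\big]^{1/2},\qquad e^{\rm w}(S,A)=\mathbb E\Big[\sup_{\|f\|\le1}\|(S-A)f\|^2\Big]^{1/2}.$$ For $n\le d$ and $l\in\mathbb N$ let the building block $U^{(n)}_l$ be a randomized linear algorithm from $F^{(n)}$ to $G^{(n)}$: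 a random bounded linear operator such that, for every $\omega_n\in\Omega^{(n)}$, $U^{(n)}_l(\omega_n)f$ depends on $f$ only through the values at $f$ of finitely many functionals from $\Lambda^{(n)}$ (the information used), whose number is a random variable; $m_{l,n}$ denotes its expectation. Put $U^{(n)}_0=0$, $m_{0,n}=0$, $\Delta^{(n)}_l=U^{(n)}_l-U^{(n)}_{l-1}$, and for $L\ge d$ $$A(L,d)(\omega)=\sum_{\mathbf l\in\mathbb N^d,\ |\mathbf l|\le L}\ \bigotimes_{n=1}^d\Delta^{(n)}_{l_n}(\omega_n),\qquad |\mathbf l|=l_1+\dots+l_d .$$ Equivalently $A(L,d)=\sum_{L-d+1\le|\mathbf l|\le L}(-1)^{L-|\mathbf l|}\binom{d-1}{L-|\mathbf l|}\bigotimes_nU^{(n)}_{l_n}$; accordingly, the information used by $A(L,d)(\omega)$ is the set of all functionals $\bigotimes_n\lambda_n$ on $F_d$ for which there is $\mathbf l\in\mathbb N^d$ with $L-d+1\le|\mathbf l|\le L$ such that each $\lambda_n$ is used by $U^{(n)}_{l_n}(\omega_n)$. Let $N=N(L,d)$ be the expected number of its elements. Let ${\rm x}\in\{{\rm r},{\rm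 w}\}$, $B,C,E>0$, $D\in(0,1)$, $1\le K_{\rm low}\le K_{\rm up}$, $K>1$, and $\alpha=\log(1/D)/\log K$. Assume for all $n\le d$ and $l\in\mathbb N$: 1. $\|S^{(n)}\|_{\rm op}\le B$ and $e^{\rm x}(S^{(n)},U^{(n)}_l)\le CD^l$; 2. if ${\rm x}={\rm r}$: $U^{(n)}_lf\in L^2(\Omega^{(n)},G^{(n)})$ for all $f\in F^{(n)}$, and $\sup_{\|f\|\le1}\mathbb E\big[\|\Delta^{(n)}_lf\|^2\big]^{1/2}\le ED^l$; 3. if ${\rm x}={\rm w}$: $\omega_n\mapsto\sup_{\|f\|\le1}\|U^{(n)}_l(\omega_n)f\|$ is measurable and in $L^2(\Omega^{(n)})$, and $\mathbb E\big[\sup_{\|f\|\le1}\|\Delta^{(n)}_lf\|^2\big]^{1/2}\le ED^l$; 4. $K_{\rm low}K^{l-1}(K-1)\le m_{l,n}-m_{l-1,n}\le K_{\rm up}K^{l-1}(K-1)$. Then there exist constants $C_0,C_1>0$, depending only on ${\rm x},B,C,D,E,K_{\rm low},K_{\rm up},K$ (and in particular neither on $d$ nor on $L$), such that for all $d\in\mathbb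 N$ and all $L\ge d$ the number $N=N(L,d)$ is finite and $$e^{\rm x}(S_1,A(L,1))\le C_0C_1N^{-\alpha}\quad\text{if }d=1,$$ $$e^{\rm x}(S_d,A(L,d))\le C_0C_1^d\Big(1+\frac{\log N}{d-1}\Big)^{(d-1)(\alpha+1)}N^{-\alpha}\quad\text{if }d\ge2\text{ and }N\ge1.$$ -/

import Mathlib

open MeasureTheory
open scoped ENNReal TensorProduct Matrix

set_option linter.unusedSectionVars false

noncomputable section

namespace Smolyak

universe u v w

/-! ### Hilbert space tensor products and tensor product operators -/

section Tensor

variable {ι : Type*} [Fintype ι]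

/-- The Schur product of finitely many positive semidefinite matrices is positive semidefinite. -/
theorem posSemidef_prod {κ : Type*} [Fintype κ] (s : Finset ι) (A : ι → Matrix κ κ ℝ)
    (hA : ∀ i, (A i).PosSemidef) :
    (Matrix.of fun a b => ∏ i ∈ s, A i a b).PosSemidef := by
  classical
  induction s using Finset.induction_on with
  | empty =>
    have h := Matrix.posSemidef_vecMulVec_self_star (R := ℝ) (fun _ : κ => (1 : ℝ))
    convert h using 1
    ext a b
    simp [Matrix.vecMulVec]
  | insert i s hi ih =>
    have h := (hA i).hadamard ih
    have e : (Matrix.of fun a b => ∏ j ∈ insert i s, A j a b)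
        = A i ⊙ Matrix.of fun a b => ∏ j ∈ s, A j a b := by
      ext a b
      simp [Finset.prod_insert hi]
    rw [e]
    exact h

/-- The Schur product is monotone on positive semidefinite matrices. -/
theorem posSemidef_prod_sub {κ : Type*} [Fintype κ] (s : Finset ι) (A B : ι → Matrix κ κ ℝ)
    (hA : ∀ i, (A i).PosSemidef) (hAB : ∀ i, (B i - A i).PosSemidef) :
    (Matrix.of fun a b => ∏ i ∈ s, B i a b - ∏ i ∈ s, A i a b).PosSemidef := by
  classical
  have hB : ∀ i, (B i).PosSemidef := fun i => by
    have h := (hAB i).add (hA i)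
    simpa using h
  induction s using Finset.induction_on with
  | empty =>
    convert Matrix.PosSemidef.zero (n := κ) (R := ℝ) using 1
    ext a b
    simp
  | insert i s hi ih =>
    have h := ((hAB i).hadamard (posSemidef_prod s A hA)).add ((hB i).hadamard ih)
    have e : (Matrix.of fun a b => ∏ j ∈ insert i s, B j a b - ∏ j ∈ insert i s, A j a b)
        = (B i - A i) ⊙ (Matrix.of fun a b => ∏ j ∈ s, A j a b)
          + B i ⊙ (Matrix.of fun a b => ∏ j ∈ s, B j a b - ∏ j ∈ s, A j a b) := by
      ext a b
      simp [Finset.prod_insert hi]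
      ring
    rw [e]
    exact h

variable (F : ι → Type u) [∀ i, NormedAddCommGroup (F i)] [∀ i, InnerProductSpace ℝ (F i)]

/-- The algebraic tensor product of the spaces `F i` (a type synonym, which is going to carry the
Hilbert space scalar product instead of the projective norm). -/
def AlgTensor : Type _ := ⨂[ℝ] i, F i

instance : AddCommGroup (AlgTensor F) := inferInstanceAs (AddCommGroup (⨂[ℝ] i, F i))
instance : Module ℝ (AlgTensor F) := inferInstanceAs (Module ℝ (⨂[ℝ] i, F i))

variable {F}

/-- The elementary tensor `⨂ f i` in the algebraic tensor product. -/
def algProd (f : ∀ i, F i) : AlgTensor F := PiTensorProduct.tprod ℝ f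

variable (F)

/-- The bilinear form on the algebraic tensor product with
`⟨⨂ f i, ⨂ g i⟩ = ∏ ⟨f i, g i⟩`. -/
def tensorForm : AlgTensor F →ₗ[ℝ] AlgTensor F →ₗ[ℝ] ℝ :=
  (PiTensorProduct.map₂ (fun i => innerₗ (F i))).compr₂
    (PiTensorProduct.lift (MultilinearMap.mkPiAlgebra ℝ ι ℝ))

variable {F}

theorem tensorForm_algProd (f g : ∀ i, F i) :
    tensorForm F (algProd f) (algProd g) = ∏ i, inner ℝ (f i) (g i) := by
  change PiTensorProduct.lift (MultilinearMap.mkPiAlgebra ℝ ι ℝ)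
    (PiTensorProduct.map₂ (fun i => innerₗ (F i)) (PiTensorProduct.tprod ℝ f)
      (PiTensorProduct.tprod ℝ g)) = _
  rw [PiTensorProduct.map₂_tprod_tprod, PiTensorProduct.lift.tprod]
  simp

theorem exists_eq_sum_algProd (x : AlgTensor F) :
    ∃ (n : ℕ) (c : Fin n → ℝ) (f : Fin n → ∀ i, F i), x = ∑ a, c a • algProd (f a) := by
  refine PiTensorProduct.induction_on (motive := fun x : ⨂[ℝ] i, F i =>
    ∃ (n : ℕ) (c : Fin n → ℝ) (f : Fin n → ∀ i, F i),
      (x : AlgTensor F) = ∑ a, c a • algProd (f a)) x ?_ ?_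
  · intro r f
    exact ⟨1, fun _ => r, fun _ => f, by simp; rfl⟩
  · rintro x y ⟨n, c, f, hx⟩ ⟨m, c', f', hy⟩
    refine ⟨n + m, Fin.append c c', Fin.append f f', ?_⟩
    rw [Fin.sum_univ_add]
    simp only [Fin.append_left, Fin.append_right]
    rw [← hx, ← hy]
    rfl

theorem tensorForm_sum {n : ℕ} (c : Fin n → ℝ) (f : Fin n → ∀ i, F i) :
    tensorForm F (∑ a, c a • algProd (f a)) (∑ a, c a • algProd (f a))
      = c ⬝ᵥ (Matrix.of fun a b => ∏ i, inner ℝ (f a i) (f b i)) *ᵥ c := by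
  simp only [map_sum, map_smul, LinearMap.sum_apply, LinearMap.smul_apply, tensorForm_algProd,
    dotProduct, Matrix.mulVec, Matrix.of_apply, smul_eq_mul, Finset.mul_sum]
  rw [Finset.sum_comm]
  refine Finset.sum_congr rfl fun a _ => Finset.sum_congr rfl fun b _ => ?_
  ring

theorem tensorForm_symm (x y : AlgTensor F) : tensorForm F y x = tensorForm F x y := by
  obtain ⟨n, c, f, rfl⟩ := exists_eq_sum_algProd x
  obtain ⟨m, c', f', rfl⟩ := exists_eq_sum_algProd y
  simp only [map_sum, map_smul, LinearMap.sum_apply, LinearMap.smul_apply, tensorForm_algProd,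
    smul_eq_mul, Finset.mul_sum]
  rw [Finset.sum_comm]
  refine Finset.sum_congr rfl fun a _ => Finset.sum_congr rfl fun b _ => ?_
  rw [Finset.prod_congr rfl fun i _ => real_inner_comm (f b i) (f' a i)]
  ring

theorem tensorForm_nonneg (x : AlgTensor F) : 0 ≤ tensorForm F x x := by
  obtain ⟨n, c, f, rfl⟩ := exists_eq_sum_algProd x
  rw [tensorForm_sum]
  have h := posSemidef_prod Finset.univ (fun i => Matrix.gram ℝ fun a => f a i)
    (fun i => Matrix.posSemidef_gram ℝ _)
  simpa [Matrix.gram] using h.dotProduct_mulVec_nonneg c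

variable (F)

/-- The scalar product on the algebraic tensor product. -/
@[reducible]
def tensorCore : PreInnerProductSpace.Core ℝ (AlgTensor F) where
  inner x y := tensorForm F x y
  conj_inner_symm x y := by simpa using tensorForm_symm x y
  re_inner_nonneg x := by simpa using tensorForm_nonneg x
  add_left x y z := by simp
  smul_left x y r := by simp

instance : SeminormedAddCommGroup (AlgTensor F) :=
  @InnerProductSpace.Core.toSeminormedAddCommGroup ℝ _ _ _ _ (tensorCore F)

instance : InnerProductSpace ℝ (AlgTensor F) := InnerProductSpace.ofCore (tensorCore F)

/-- The Hilbert space tensor product of the spaces `F i`: the completion of the algebraic tensor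
product with respect to the scalar product `⟨⨂ f i, ⨂ g i⟩ = ∏ ⟨f i, g i⟩`. -/
abbrev HilbertTensor : Type _ := UniformSpace.Completion (AlgTensor F)

variable {F}

/-- The elementary tensor `⨂ f i` in the Hilbert space tensor product. -/
def hprod (f : ∀ i, F i) : HilbertTensor F := (algProd f : AlgTensor F)

theorem inner_algTensor (x y : AlgTensor F) : inner ℝ x y = tensorForm F x y := rfl

theorem inner_hprod (f g : ∀ i, F i) :
    inner ℝ (hprod f) (hprod g) = ∏ i, inner ℝ (f i) (g i) := by
  rw [hprod, hprod, UniformSpace.Completion.inner_coe, inner_algTensor, tensorForm_algProd]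

variable {G : ι → Type v} [∀ i, NormedAddCommGroup (G i)] [∀ i, InnerProductSpace ℝ (G i)]

/-- The tensor product of linear operators, on the algebraic tensor product. -/
def algTensorOp (T : ∀ i, F i →L[ℝ] G i) : AlgTensor F →ₗ[ℝ] AlgTensor G :=
  PiTensorProduct.map fun i => (T i : F i →ₗ[ℝ] G i)

theorem algTensorOp_algProd (T : ∀ i, F i →L[ℝ] G i) (f : ∀ i, F i) :
    algTensorOp T (algProd f) = algProd fun i => T i (f i) :=
  PiTensorProduct.map_tprod _ _

theorem dotProduct_gram_mulVec {X : Type*} [NormedAddCommGroup X] [InnerProductSpace ℝ X]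
    {n : ℕ} (g : Fin n → X) (c : Fin n → ℝ) :
    c ⬝ᵥ Matrix.gram ℝ g *ᵥ c = ‖∑ a, c a • g a‖ ^ 2 := by
  rw [← real_inner_self_eq_norm_sq]
  simp only [dotProduct, Matrix.mulVec, Matrix.gram_apply, sum_inner, inner_sum,
    real_inner_smul_left, real_inner_smul_right, Finset.mul_sum]
  refine Finset.sum_congr rfl fun a _ => Finset.sum_congr rfl fun b _ => ?_
  rw [real_inner_comm]
  ring

theorem posSemidef_gram_sub {E H : Type*} [NormedAddCommGroup E] [InnerProductSpace ℝ E]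
    [NormedAddCommGroup H] [InnerProductSpace ℝ H] (T : E →L[ℝ] H) {n : ℕ} (f : Fin n → E) :
    (‖T‖ ^ 2 • Matrix.gram ℝ f - Matrix.gram ℝ fun a => T (f a)).PosSemidef := by
  refine Matrix.PosSemidef.of_dotProduct_mulVec_nonneg ?_ fun c => ?_
  · refine Matrix.IsHermitian.sub ?_ (Matrix.isHermitian_gram ℝ _)
    ext a b
    simp [Matrix.gram, real_inner_comm]
  · have h1 := dotProduct_gram_mulVec f c
    have h2 := dotProduct_gram_mulVec (fun a => T (f a)) c
    have h3 : ∑ a, c a • T (f a) = T (∑ a, c a • f a) := by simp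
    have h4 := T.le_opNorm (∑ a, c a • f a)
    have h5 : ‖T (∑ a, c a • f a)‖ ^ 2 ≤ (‖T‖ * ‖∑ a, c a • f a‖) ^ 2 := by gcongr
    rw [star_trivial, Matrix.sub_mulVec, dotProduct_sub, Matrix.smul_mulVec, dotProduct_smul,
      h1, h2, h3, smul_eq_mul]
    nlinarith

theorem norm_algTensorOp_le (T : ∀ i, F i →L[ℝ] G i) (x : AlgTensor F) :
    ‖algTensorOp T x‖ ≤ (∏ i, ‖T i‖) * ‖x‖ := by
  refine abs_le_of_sq_le_sq' ?_ (by positivity) |>.2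
  rw [mul_pow, ← real_inner_self_eq_norm_sq, ← real_inner_self_eq_norm_sq, inner_algTensor,
    inner_algTensor]
  obtain ⟨n, c, f, rfl⟩ := exists_eq_sum_algProd x
  have hT : algTensorOp T (∑ a, c a • algProd (f a))
      = ∑ a, c a • algProd fun i => T i (f a i) := by
    simp [algTensorOp_algProd]
  rw [hT, tensorForm_sum, tensorForm_sum]
  have h := posSemidef_prod_sub Finset.univ (fun i => Matrix.gram ℝ fun a => T i (f a i))
    (fun i => ‖T i‖ ^ 2 • Matrix.gram ℝ fun a => f a i)
    (fun i => Matrix.posSemidef_gram ℝ _) (fun i => posSemidef_gram_sub (T i) _)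
  have h' := h.dotProduct_mulVec_nonneg c
  have e : (Matrix.of fun a b => ∏ i, (‖T i‖ ^ 2 • Matrix.gram ℝ fun a => f a i) a b
        - ∏ i, (Matrix.gram ℝ fun a => T i (f a i)) a b)
      = (∏ i, ‖T i‖) ^ 2 • (Matrix.of fun a b => ∏ i, inner ℝ (f a i) (f b i))
        - Matrix.of fun a b => ∏ i, inner ℝ (T i (f a i)) (T i (f b i)) := by
    ext a b
    simp [Matrix.gram_apply, Finset.prod_mul_distrib, Finset.prod_pow]
  rw [e, star_trivial, Matrix.sub_mulVec, dotProduct_sub, Matrix.smul_mulVec, dotProduct_smul,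
    smul_eq_mul] at h'
  linarith

/-- The tensor product operator `⨂ T i`: the bounded linear operator between the Hilbert space
tensor products that maps `⨂ f i` to `⨂ T i (f i)`. -/
def tensorOp (T : ∀ i, F i →L[ℝ] G i) : HilbertTensor F →L[ℝ] HilbertTensor G :=
  ((algTensorOp T).mkContinuous (∏ i, ‖T i‖) (norm_algTensorOp_le T)).completion

theorem tensorOp_hprod (T : ∀ i, F i →L[ℝ] G i) (f : ∀ i, F i) :
    tensorOp T (hprod f) = hprod fun i => T i (f i) := by
  rw [tensorOp, hprod, ContinuousLinearMap.completion_apply_coe]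
  exact congrArg _ (algTensorOp_algProd T f)

/-- The tensor product functional `⨂ ℓ i`, that is, the bounded linear functional on the Hilbert
space tensor product that maps `⨂ f i` to `∏ ℓ i (f i)`. -/
def tensorFunctional [∀ i, CompleteSpace (F i)] (ℓ : ∀ i, StrongDual ℝ (F i)) :
    StrongDual ℝ (HilbertTensor F) :=
  innerSL ℝ (hprod fun i => (InnerProductSpace.toDual ℝ (F i)).symm (ℓ i))

theorem tensorFunctional_hprod [∀ i, CompleteSpace (F i)] (ℓ : ∀ i, StrongDual ℝ (F i))
    (f : ∀ i, F i) : tensorFunctional ℓ (hprod f) = ∏ i, ℓ i (f i) := by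
  simp [tensorFunctional, inner_hprod]

end Tensor

/-! ### Randomized errors -/

/-- The two error criteria: randomized error and (root mean square) worst case error. -/
inductive Criterion
  | ran
  | wor

section Operators

variable {Ω : Type w} [MeasurableSpace Ω] {F : Type u} [NormedAddCommGroup F]
  [InnerProductSpace ℝ F] {G : Type v} [NormedAddCommGroup G] [InnerProductSpace ℝ G]

/-- The size of a random operator `T`, which is
`sup_{‖f‖ ≤ 1} (E ‖T f‖²)^{1/2}` for the randomized criterion and
`(E sup_{‖f‖ ≤ 1} ‖T f‖²)^{1/2}` for the worst case criterion. -/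
def ranSize (x : Criterion) (P : Measure Ω) (T : Ω → F →L[ℝ] G) : ℝ≥0∞ :=
  match x with
  | .ran => ⨆ (f : F) (_ : ‖f‖ ≤ 1), (∫⁻ ω, ‖T ω f‖ₑ ^ 2 ∂P) ^ (1 / 2 : ℝ)
  | .wor => (∫⁻ ω, ⨆ (f : F) (_ : ‖f‖ ≤ 1), ‖T ω f‖ₑ ^ 2 ∂P) ^ (1 / 2 : ℝ)

/-- The error `eˣ(S, A)` of the random operator `A` as an approximation of `S`. -/
def err (x : Criterion) (P : Measure Ω) (S : F →L[ℝ] G) (A : Ω → F →L[ℝ] G) : ℝ≥0∞ :=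
  ranSize x P fun ω => S - A ω

variable (Ω G) in
/-- A randomized linear algorithm with admissible information functionals `Λ`: a randomized linear
operator which, for each `ω`, depends on `f` only through the values `ℓ f` of the finitely many
functionals `ℓ ∈ info ω`, the number of which is a random variable. (As `G` will be separable,
strong measurability of `A f` is the same as Borel measurability.) -/
structure RanLinAlg (Λ : Set (StrongDual ℝ F)) where
  op : Ω → F →L[ℝ] G
  stronglyMeasurable_op : ∀ f, StronglyMeasurable fun ω => op ω f
  info : Ω → Finset (StrongDual ℝ F)
  info_subset : ∀ ω, ↑(info ω) ⊆ Λ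
  factors : ∀ ω, ∃ φ : (info ω → ℝ) → G, ∀ f, op ω f = φ fun ℓ => (ℓ : StrongDual ℝ F) f
  measurable_card : Measurable fun ω => (info ω).card

/-- The zero algorithm, which uses no information. -/
def RanLinAlg.zero (Λ : Set (StrongDual ℝ F)) : RanLinAlg Ω G Λ where
  op _ := 0
  stronglyMeasurable_op _ := stronglyMeasurable_const
  info _ := ∅
  info_subset _ := by simp
  factors _ := ⟨fun _ => 0, fun _ => rfl⟩
  measurable_card := measurable_const

/-- The expected number of information functionals. -/
def ranCard (P : Measure Ω) (info : Ω → Finset (StrongDual ℝ F)) : ℝ≥0∞ :=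
  ∫⁻ ω, ((info ω).card : ℝ≥0∞) ∂P

/-- The sequence of building blocks with the convention `U 0 = 0` (the given `U 0` is not used). -/
def block {Λ : Set (StrongDual ℝ F)} (U : ℕ → RanLinAlg Ω G Λ) : ℕ → RanLinAlg Ω G Λ
  | 0 => RanLinAlg.zero Λ
  | l + 1 => U (l + 1)

/-- The difference operators `Δ l = U l - U (l - 1)`, `l ≥ 1`, with `Δ 0 = 0`. -/
def delta {Λ : Set (StrongDual ℝ F)} (U : ℕ → RanLinAlg Ω G Λ) (l : ℕ) (ω : Ω) : F →L[ℝ] G :=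
  (block U l).op ω - (block U (l - 1)).op ω

end Operators

/-! ### The Smolyak method -/

section Method

variable {d : ℕ} {Ω : Fin d → Type w} [∀ n, MeasurableSpace (Ω n)]
  {F : Fin d → Type u} [∀ n, NormedAddCommGroup (F n)] [∀ n, InnerProductSpace ℝ (F n)]
  {G : Fin d → Type v} [∀ n, NormedAddCommGroup (G n)] [∀ n, InnerProductSpace ℝ (G n)]
  {Λ : ∀ n, Set (StrongDual ℝ (F n))}

/-- `Q(L, d)`, the set of `l` in `{1, 2, …}^d` with `|l| ≤ L`. -/
def levels (L d : ℕ) : Finset (Fin d → ℕ) :=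
  (Fintype.piFinset fun _ => Finset.Icc 1 L).filter fun l => ∑ n, l n ≤ L

/-- The randomized Smolyak method `A(L, d)(ω) = ∑_{l ∈ Q(L, d)} ⨂ Δ_{l_n}(ω_n)`. -/
def smolyak (U : ∀ n, ℕ → RanLinAlg (Ω n) (G n) (Λ n)) (L : ℕ) (ω : ∀ n, Ω n) :
    HilbertTensor F →L[ℝ] HilbertTensor G :=
  ∑ l ∈ levels L d, tensorOp fun n => delta (U n) (l n) (ω n)

open Classical in
/-- The information functionals used by `A(L, d)(ω)`. By the representation
`A(L, d) = ∑_{L-d+1 ≤ |l| ≤ L} (-1)^(L-|l|) (d-1 choose L-|l|) ⨂ U_{l_n}`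
these are the tensor products of the functionals used by the building blocks `U_{l_n}(ω_n)`
with `L-d+1 ≤ |l| ≤ L`. -/
def smolyakInfo [∀ n, CompleteSpace (F n)] (U : ∀ n, ℕ → RanLinAlg (Ω n) (G n) (Λ n)) (L : ℕ)
    (ω : ∀ n, Ω n) : Finset (StrongDual ℝ (HilbertTensor F)) :=
  ((levels L d).filter fun l => L + 1 ≤ ∑ n, l n + d).biUnion fun l =>
    (Fintype.piFinset fun n => (U n (l n)).info (ω n)).image tensorFunctional

/-- The square integrability required of a building block: for the randomized criterion
`A f ∈ L²` for all `f`, and for the worst case criterion that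
`ω ↦ sup_{‖f‖ ≤ 1} ‖A(ω) f‖ = ‖A(ω)‖` is measurable and in `L²`. -/
def SquareIntegrable {Ω' : Type w} [MeasurableSpace Ω'] {F' : Type u} [NormedAddCommGroup F']
    [InnerProductSpace ℝ F'] {G' : Type v} [NormedAddCommGroup G'] [InnerProductSpace ℝ G']
    (x : Criterion) (P : Measure Ω') (A : Ω' → F' →L[ℝ] G') : Prop :=
  match x with
  | .ran => ∀ f, MemLp (fun ω => A ω f) 2 P
  | .wor => Measurable (fun ω => ‖A ω‖) ∧ MemLp (fun ω => ‖A ω‖) 2 P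

/-- The hypotheses on the solution operators and the errors of the building blocks. -/
structure ErrorBounds (x : Criterion) (P : ∀ n, Measure (Ω n)) (S : ∀ n, F n →L[ℝ] G n)
    (U : ∀ n, ℕ → RanLinAlg (Ω n) (G n) (Λ n)) (B C D E : ℝ) : Prop where
  squareIntegrable : ∀ n l, 1 ≤ l → SquareIntegrable x (P n) (U n l).op
  norm_le : ∀ n, ‖S n‖ ≤ B
  err_le : ∀ n l, 1 ≤ l → err x (P n) (S n) (U n l).op ≤ ENNReal.ofReal (C * D ^ l)
  delta_le : ∀ n l, 1 ≤ l → ranSize x (P n) (delta (U n) l) ≤ ENNReal.ofReal (E * D ^ l)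

/-- The growth condition
`Klow K^(l-1) (K-1) ≤ m_{l,n} - m_{l-1,n} ≤ Kup K^(l-1) (K-1)`, `l ≥ 1`, on the expected numbers
`m_{l,n}` of functionals used by the building blocks, where `m_{0,n} = 0`. It is written without
subtraction, so that it includes that all `m_{l,n}` are finite. -/
def CostGrowth (P : ∀ n, Measure (Ω n)) (U : ∀ n, ℕ → RanLinAlg (Ω n) (G n) (Λ n))
    (Klow Kup K : ℝ) : Prop :=
  ∀ n l, 1 ≤ l →
    ranCard (P n) (block (U n) (l - 1)).info + ENNReal.ofReal (Klow * K ^ (l - 1) * (K - 1))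
        ≤ ranCard (P n) (block (U n) l).info ∧
      ranCard (P n) (block (U n) l).info
        ≤ ranCard (P n) (block (U n) (l - 1)).info
          + ENNReal.ofReal (Kup * K ^ (l - 1) * (K - 1))

end Method

end Smolyak

end

/-!
With a decomposition that peels off one coordinate after the other, the error `⨂ S n - A(L, d)`
of the Smolyak method is a sum of elementary tensors, whose factors are the errors `S n - U n l`,
the differences `Δ l` and the operators `S n` (`size_sub_sum_levels`). The coordinates are
independent, so that the size of such a tensor is at most the product of the sizes of its factors
(`majorizedSizeLE_tensorOp`). For the worst case criterion this is the multiplicativity of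
operator norms and of expectations. For the randomized criterion, random operators of finite mean
square size are viewed as operators `F n → L²(Ω n, G n)`, whose tensor product has as its norm at
most the product of the norms (`lintegral_tensorOp_le`). Altogether
`eˣ(⨂ S n, A(L, d)) ≤ C D ^ L b (E + B / D) ^ (d - 1)`, where `b = (L - 1).choose (d - 1)` (`err_smolyak_le`).

Counting the functionals with multiplicity gives `N ≤ Kup ^ d (K / (K - 1)) b K ^ L`
(`ranCard_smolyakInfo_le` and `sum_levels_pow_le`). As `K ^ α = 1 / D`, this bounds `D ^ L` by
`N ^ (-α)`, up to factors that are exponential in `d` and up to `b ^ α` (`pow_le_of_cost_le`). It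
remains to bound `b` in terms of `log N` (`error_le_of_cost_le`). No lower bound of `N` in terms
of `L` is used for `d ≥ 2`: different tuples of functionals may have the same tensor product. If
`log N ≥ (L - 1) (log K) / 2`, then `b ≤ (e (L - 1) / (d - 1)) ^ (d - 1)` is good enough.
Otherwise `N ^ (-α) ≥ D ^ ((L - 1) / 2)`, and the remaining factor `D ^ ((L - 1) / 2)` of the
error compensates `b` up to a factor that is exponential in `d`.
-/

namespace Smolyak

/-! ### The combinatorial decomposition of the error -/

theorem levels_zero (L : ℕ) : levels L 0 = {default} := by
  ext l
  rw [Subsingleton.elim l default]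
  simpa [levels] using Subsingleton.elim (α := Fin 0 → ℕ) _ _

/-- Peeling off the first coordinate. If it exceeds `L - d`, there is no room left for the
others. -/
theorem sum_levels_succ {V : Type*} [AddCommMonoid V] (L d : ℕ) (g : (Fin (d + 1) → ℕ) → V) :
    ∑ l ∈ levels L (d + 1), g l
      = ∑ a ∈ Finset.Icc 1 (L - d), ∑ l ∈ levels (L - a) d, g (Fin.cons a l) := by
  rw [Finset.sum_sigma']
  refine (Finset.sum_bij' (fun (p : Σ _ : ℕ, Fin d → ℕ) _ => (Fin.cons p.1 p.2 : Fin (d + 1) → ℕ))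
    (fun l _ => ⟨l 0, fun n => l n.succ⟩) ?_ ?_ ?_ ?_ ?_).symm
  · rintro ⟨a, l⟩ h
    simp only [levels, Finset.mem_sigma, Finset.mem_filter, Fintype.mem_piFinset,
      Finset.mem_Icc, Fin.sum_univ_succ, Fin.cons_zero, Fin.cons_succ, Fin.forall_fin_succ]
      at h ⊢
    obtain ⟨h1, h2, h3⟩ := h
    exact ⟨⟨by omega, fun n => ⟨(h2 n).1, by have := (h2 n).2; omega⟩⟩, by omega⟩
  · intro l h
    simp only [levels, Finset.mem_sigma, Finset.mem_filter, Fintype.mem_piFinset,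
      Finset.mem_Icc, Fin.sum_univ_succ] at h ⊢
    obtain ⟨h1, h2⟩ := h
    have h3 : d ≤ ∑ n : Fin d, l n.succ := by
      calc d = ∑ n : Fin d, 1 := by simp
        _ ≤ _ := Finset.sum_le_sum fun n _ => (h1 n.succ).1
    refine ⟨⟨(h1 0).1, by omega⟩, fun n => ⟨(h1 n.succ).1, ?_⟩, by omega⟩
    have : l n.succ ≤ ∑ n : Fin d, l n.succ :=
      Finset.single_le_sum (f := fun n : Fin d => l n.succ) (fun _ _ => Nat.zero_le _)
        (Finset.mem_univ n)
    omega
  · rintro ⟨a, l⟩ h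
    rfl
  · intro l h
    exact Fin.cons_self_tail l
  · intro _ _
    rfl

/-- The hockey stick identity, in the form needed for peeling off the first coordinate. -/
theorem sum_choose_sub (L d : ℕ) :
    ∑ a ∈ Finset.Icc 1 (L - (d + 1)), (L - a - 1).choose d = (L - 1).choose (d + 1) := by
  induction L with
  | zero => simp
  | succ L ih =>
    by_cases h : L < d + 1
    · rw [Nat.choose_eq_zero_of_lt (by omega), show L + 1 - (d + 1) = 0 by omega]
      simp
    · have hI : ∀ (m : ℕ) (f : ℕ → ℕ),
          ∑ a ∈ Finset.Icc 1 m, f a = ∑ i ∈ Finset.range m, f (i + 1) := fun m f => by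
        induction m with
        | zero => simp
        | succ m ih => rw [Finset.sum_Icc_succ_top (by omega), ih, Finset.sum_range_succ]
      obtain ⟨k, rfl⟩ : ∃ k, L = k + 1 := ⟨L - 1, by omega⟩
      rw [hI] at ih ⊢
      rw [show k + 1 + 1 - (d + 1) = (k + 1 - (d + 1)) + 1 by omega, Finset.sum_range_succ']
      have h2 : ∀ a, k + 1 + 1 - (a + 1 + 1) - 1 = k + 1 - (a + 1) - 1 := fun a => by omega
      simp only [h2, ih]
      simp [Nat.choose_succ_succ, add_comm]

/-- The decomposition behind the error bound, for an abstract multilinear map `M`. With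
`R = S 0 - ∑_{a ≤ L - d} Δ 0 a`, peeling off the first of `d + 1` coordinates gives
`M S - ∑_l M (Δ_l) = M (R, S') + ∑_{a ≤ L - d} (M (Δ 0 a, S') - ∑_{l'} M (Δ 0 a, Δ_{l'}))`,
where the primes refer to the remaining coordinates and `l'` has the levels up to `L - a`. The last
terms are errors in dimension `d`, to which the induction hypothesis applies. The bound is zero in
dimension zero, where the method is exact.

The relation `W n T r` expresses that `T` has size at most `r`, and `Q v r` that `v` has size at
most `r`. The factor `c` stands for the sizes of the factors that have already been peeled off. -/
theorem size_sub_sum_levels {V : Type*} [AddCommGroup V] [Module ℝ V] (Q : V → ℝ → Prop)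
    (hQ0 : ∀ r, 0 ≤ r → Q 0 r) (hQadd : ∀ v w r s, Q v r → Q w s → Q (v + w) (r + s))
    (hQmono : ∀ v r s, r ≤ s → Q v r → Q v s)
    {B C D E : ℝ} (hB : 0 ≤ B) (hC : 0 ≤ C) (hD : 0 < D) (hE : 0 ≤ E) :
    ∀ (d : ℕ) (X : Fin d → Type*) [∀ n, AddCommGroup (X n)] [∀ n, Module ℝ (X n)]
      (W : ∀ n, X n → ℝ → Prop) (M : MultilinearMap ℝ X V) (c : ℝ), 0 ≤ c →
      (∀ (T : ∀ n, X n) (r : Fin d → ℝ), (∀ n, W n (T n) (r n)) → Q (M T) (c * ∏ n, r n)) →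
      ∀ (S : ∀ n, X n) (Δ : ∀ n, ℕ → X n), (∀ n, W n (S n) B) →
      (∀ n l, 1 ≤ l → W n (S n - ∑ a ∈ Finset.Icc 1 l, Δ n a) (C * D ^ l)) →
      (∀ n l, 1 ≤ l → W n (Δ n l) (E * D ^ l)) →
      ∀ L, d ≤ L →
        Q (M S - ∑ l ∈ levels L d, M fun n => Δ n (l n))
          (c * if d = 0 then 0
            else C * D ^ L * (L - 1).choose (d - 1) * (E + B / D) ^ (d - 1)) := by
  intro d
  induction d with
  | zero =>
    intro X _ _ W M c hc hM S Δ hS hU hΔ L hL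
    have e' : (fun n : Fin 0 => Δ n ((default : Fin 0 → ℕ) n)) = S := Subsingleton.elim _ _
    rw [levels_zero, Finset.sum_singleton, e', sub_self]
    exact hQ0 _ (by simp)
  | succ d ih =>
    intro X _ _ W M c hc hM S Δ hS hU hΔ L hL
    have hsum : ∀ {β : Type} (s : Finset β) (v : β → V) (r : β → ℝ),
        (∀ b ∈ s, Q (v b) (r b)) → Q (∑ b ∈ s, v b) (∑ b ∈ s, r b) := by
      intro β s v r h
      classical
      induction s using Finset.induction_on with
      | empty => simpa using hQ0 0 le_rfl
      | insert b s hb ihs =>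
        rw [Finset.sum_insert hb, Finset.sum_insert hb]
        exact hQadd _ _ _ _ (h b (by simp)) (ihs fun b' hb' => h b' (by simp [hb']))
    have hcons : ∀ (T₀ : X 0) (r₀ : ℝ), W 0 T₀ r₀ → ∀ (T : ∀ n : Fin d, X n.succ)
        (r : Fin d → ℝ), (∀ n, W (Fin.succ n) (T n) (r n)) →
        Q (M.curryLeft T₀ T) (c * r₀ * ∏ n, r n) := by
      intro T₀ r₀ h0 T r h
      have := hM (Fin.cons T₀ T) (Fin.cons r₀ r) fun n => by
        refine Fin.cases ?_ (fun n => ?_) n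
        · simpa using h0
        · simpa using h n
      rw [Fin.prod_univ_succ] at this
      simpa [mul_assoc] using this
    have hMS : M S = M.curryLeft (S 0 - ∑ a ∈ Finset.Icc 1 (L - d), Δ 0 a) (fun n => S n.succ)
        + ∑ a ∈ Finset.Icc 1 (L - d), M.curryLeft (Δ 0 a) (fun n => S n.succ) := by
      rw [map_sub, map_sum, _root_.sub_apply, _root_.sum_apply, sub_add_cancel,
        MultilinearMap.curryLeft_apply]
      congr 1
      exact (Fin.cons_self_tail S).symm
    have hMΔ : ∀ (a : ℕ) (l : Fin d → ℕ),
        (M fun n => Δ n ((Fin.cons a l : Fin (d + 1) → ℕ) n))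
          = M.curryLeft (Δ 0 a) fun n => Δ n.succ (l n) := by
      intro a l
      rw [MultilinearMap.curryLeft_apply]
      congr 1
      funext n
      refine Fin.cases ?_ (fun n => ?_) n <;> simp
    have key : M S - ∑ l ∈ levels L (d + 1), M (fun n => Δ n (l n))
        = M.curryLeft (S 0 - ∑ a ∈ Finset.Icc 1 (L - d), Δ 0 a) (fun n => S n.succ)
          + ∑ a ∈ Finset.Icc 1 (L - d), (M.curryLeft (Δ 0 a) (fun n => S n.succ)
            - ∑ l ∈ levels (L - a) d, M.curryLeft (Δ 0 a) fun n => Δ n.succ (l n)) := by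
      rw [sum_levels_succ, hMS, Finset.sum_sub_distrib, add_sub_assoc]
      simp only [hMΔ]
    rw [key]
    have h1 := hcons _ _ (hU 0 (L - d) (by omega)) (fun n => S n.succ) (fun _ => B)
      fun n => hS n.succ
    have h2 : ∀ a ∈ Finset.Icc 1 (L - d), Q _ _ := fun a ha => by
      rw [Finset.mem_Icc] at ha
      exact ih (fun n => X n.succ) (fun n => W n.succ) (M.curryLeft (Δ 0 a)) (c * (E * D ^ a))
        (by positivity) (hcons _ _ (hΔ 0 a ha.1)) (fun n => S n.succ) (fun n => Δ n.succ)
        (fun n => hS n.succ) (fun n => hU n.succ) (fun n => hΔ n.succ) (L - a) (by omega)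
    refine hQmono _ _ _ ?_ (hQadd _ _ _ _ h1 (hsum _ _ _ h2))
    have hH : 0 ≤ E + B / D := by positivity
    have hBD : B / D ≤ E + B / D := by linarith
    have hbin : (1 : ℝ) ≤ (L - 1).choose d := by
      exact_mod_cast Nat.choose_pos (by omega)
    have hDB : D ^ (L - d) * B ^ d = D ^ L * (B / D) ^ d := by
      rw [div_pow, ← Nat.sub_add_cancel (show d ≤ L by omega), pow_add, Nat.add_sub_cancel]
      field_simp
    simp only [Finset.prod_const, Finset.card_univ, Fintype.card_fin, Nat.add_sub_cancel]
    rcases d with _ | d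
    · simp
    · have h3 : ∀ a ∈ Finset.Icc 1 (L - (d + 1)), c * (E * D ^ a) * (C * D ^ (L - a)
            * ((L - a - 1).choose d : ℕ) * (E + B / D) ^ d)
          = c * C * D ^ L * (E * (E + B / D) ^ d) * ((L - a - 1).choose d : ℕ) := by
        intro a ha
        rw [Finset.mem_Icc] at ha
        rw [show D ^ L = D ^ a * D ^ (L - a) by rw [← pow_add]; congr 1; omega]
        ring
      simp only [Nat.add_one_ne_zero, if_false, Nat.add_sub_cancel]
      rw [Finset.sum_congr rfl h3, ← Finset.mul_sum, ← Nat.cast_sum, sum_choose_sub]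
      have h4 : (B / D) ^ (d + 1) ≤ (B / D) * (E + B / D) ^ d := by
        rw [pow_succ']
        gcongr
      have h5 : (B / D) ^ (d + 1)
          ≤ ((L - 1).choose (d + 1) : ℕ) * ((B / D) * (E + B / D) ^ d) :=
        h4.trans (le_mul_of_one_le_left (by positivity) hbin)
      calc _ = c * C * (D ^ (L - (d + 1)) * B ^ (d + 1))
            + c * C * D ^ L * (E * (E + B / D) ^ d) * ((L - 1).choose (d + 1) : ℕ) := by ring
        _ = c * C * D ^ L * ((B / D) ^ (d + 1)
            + (E * (E + B / D) ^ d) * ((L - 1).choose (d + 1) : ℕ)) := by rw [hDB]; ring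
        _ ≤ c * C * D ^ L * (((L - 1).choose (d + 1) : ℕ) * ((B / D) * (E + B / D) ^ d)
            + (E * (E + B / D) ^ d) * ((L - 1).choose (d + 1) : ℕ)) := by gcongr
        _ = _ := by ring

/-! ### Tensor products of random operators -/

section TensorSize

variable {ι : Type*} [Fintype ι]

theorem lintegral_pi_prod {Ω : ι → Type*} [∀ i, MeasurableSpace (Ω i)] (P : ∀ i, Measure (Ω i))
    [∀ i, IsProbabilityMeasure (P i)] (g : ∀ i, Ω i → ℝ≥0∞) (hg : ∀ i, Measurable (g i)) :
    ∫⁻ ω, ∏ i, g i (ω i) ∂Measure.pi P = ∏ i, ∫⁻ ω, g i ω ∂P i := by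
  rw [ProbabilityTheory.lintegral_prod_eq_prod_lintegral_of_indepFun Finset.univ
    (fun i (ω : ∀ i, Ω i) => g i (ω i))
    (ProbabilityTheory.iIndepFun_pi fun i => (hg i).aemeasurable)
    fun i => (hg i).comp (measurable_pi_apply i)]
  exact Finset.prod_congr rfl fun i _ => (measurePreserving_eval P i).lintegral_comp (hg i)

variable {F G : ι → Type*} [∀ i, NormedAddCommGroup (F i)] [∀ i, InnerProductSpace ℝ (F i)]
  [∀ i, NormedAddCommGroup (G i)] [∀ i, InnerProductSpace ℝ (G i)]

theorem tensorOp_coe (T : ∀ i, F i →L[ℝ] G i) (x : AlgTensor F) :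
    tensorOp T (x : HilbertTensor F) = (algTensorOp T x : AlgTensor G) := by
  rw [tensorOp, ContinuousLinearMap.completion_apply_coe]
  rfl

theorem norm_tensorOp_le (T : ∀ i, F i →L[ℝ] G i) : ‖tensorOp T‖ ≤ ∏ i, ‖T i‖ := by
  refine ContinuousLinearMap.opNorm_le_bound _ (by positivity) fun x => ?_
  induction x using UniformSpace.Completion.induction_on with
  | hp => exact isClosed_le (by fun_prop) (by fun_prop)
  | ih x =>
    rw [tensorOp_coe, UniformSpace.Completion.norm_coe, UniformSpace.Completion.norm_coe]
    exact norm_algTensorOp_le T x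

theorem enorm_tensorOp_le (T : ∀ i, F i →L[ℝ] G i) : ‖tensorOp T‖ₑ ≤ ∏ i, ‖T i‖ₑ := by
  simp only [← ofReal_norm]
  rw [← ENNReal.ofReal_prod_of_nonneg fun _ _ => norm_nonneg _]
  exact ENNReal.ofReal_le_ofReal (norm_tensorOp_le T)

theorem clm_hilbertTensor_ext {V : Type*} [NormedAddCommGroup V] [NormedSpace ℝ V]
    {A A' : HilbertTensor F →L[ℝ] V}
    (h : ∀ x : AlgTensor F, A (x : HilbertTensor F) = A' (x : HilbertTensor F)) : A = A' := by
  ext x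
  induction x using UniformSpace.Completion.induction_on with
  | hp => exact isClosed_eq (by fun_prop) (by fun_prop)
  | ih x => exact h x

theorem algTensorOp_update [DecidableEq ι] (T : ∀ i, F i →L[ℝ] G i) (i : ι) (A : F i →L[ℝ] G i) :
    algTensorOp (Function.update T i A)
      = PiTensorProduct.map (Function.update (fun j => (T j : F j →ₗ[ℝ] G j)) i A) := by
  unfold algTensorOp
  congr 1
  funext j
  exact Function.apply_update (fun j (B : F j →L[ℝ] G j) => (B : F j →ₗ[ℝ] G j)) T i A j

theorem tensorOp_update_add [DecidableEq ι] (T : ∀ i, F i →L[ℝ] G i) (i : ι)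
    (A A' : F i →L[ℝ] G i) : tensorOp (Function.update T i (A + A'))
      = tensorOp (Function.update T i A) + tensorOp (Function.update T i A') := by
  refine clm_hilbertTensor_ext fun x => ?_
  rw [_root_.add_apply, tensorOp_coe, tensorOp_coe, tensorOp_coe,
    ← UniformSpace.Completion.coe_add]
  congr 1
  rw [algTensorOp_update, algTensorOp_update, algTensorOp_update,
    ContinuousLinearMap.toLinearMap_add, PiTensorProduct.map_update_add]
  rfl

theorem tensorOp_update_smul [DecidableEq ι] (T : ∀ i, F i →L[ℝ] G i) (i : ι) (c : ℝ)
    (A : F i →L[ℝ] G i) : tensorOp (Function.update T i (c • A))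
      = c • tensorOp (Function.update T i A) := by
  refine clm_hilbertTensor_ext fun x => ?_
  rw [_root_.smul_apply, tensorOp_coe, tensorOp_coe, ← UniformSpace.Completion.coe_smul]
  congr 1
  rw [algTensorOp_update, algTensorOp_update,
    ContinuousLinearMap.toLinearMap_smul, PiTensorProduct.map_update_smul]
  rfl

variable {Ω : ι → Type*}

theorem update_eval [DecidableEq ι] (T : ∀ i, Ω i → F i →L[ℝ] G i) (ω : ∀ i, Ω i) (i : ι)
    (A : Ω i → F i →L[ℝ] G i) : (fun j => Function.update T i A j (ω j))
      = Function.update (fun j => T j (ω j)) i (A (ω i)) := by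
  funext j
  exact Function.apply_update (fun j (B : Ω j → F j →L[ℝ] G j) => B (ω j)) T i A j

/-- The tensor product of random operators as a multilinear map: `(T i)` is sent to
`ω ↦ ⨂ T i (ω i)`. -/
noncomputable def tensorOpMultilinear (Ω : ι → Type*) (F G : ι → Type*)
    [∀ i, NormedAddCommGroup (F i)] [∀ i, InnerProductSpace ℝ (F i)]
    [∀ i, NormedAddCommGroup (G i)] [∀ i, InnerProductSpace ℝ (G i)] :
    MultilinearMap ℝ (fun i => Ω i → F i →L[ℝ] G i)
      ((∀ i, Ω i) → HilbertTensor F →L[ℝ] HilbertTensor G) where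
  toFun T ω := tensorOp fun i => T i (ω i)
  map_update_add' T i A A' := by
    funext ω
    simp only [update_eval, Pi.add_apply, tensorOp_update_add]
  map_update_smul' T i c A := by
    funext ω
    simp only [update_eval, Pi.smul_apply, tensorOp_update_smul]

/-- The random operator `T` has mean square size at most `r`, that is, `E ‖T f‖² ≤ r² ‖f‖²`. -/
structure MeanSquareBound {Ω F G : Type*} [MeasurableSpace Ω] [NormedAddCommGroup F]
    [InnerProductSpace ℝ F] [NormedAddCommGroup G] [InnerProductSpace ℝ G] (P : Measure Ω)
    (T : Ω → F →L[ℝ] G) (r : ℝ) : Prop where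
  nonneg : 0 ≤ r
  stronglyMeasurable : ∀ f, StronglyMeasurable fun ω => T ω f
  lintegral_le : ∀ f, ∫⁻ ω, ‖T ω f‖ₑ ^ 2 ∂P ≤ ENNReal.ofReal r ^ 2 * ‖f‖ₑ ^ 2

section

variable {Ω F G : Type*} [MeasurableSpace Ω] [NormedAddCommGroup F]
    [InnerProductSpace ℝ F] [NormedAddCommGroup G] [InnerProductSpace ℝ G] {P : Measure Ω}
    {T : Ω → F →L[ℝ] G} {r : ℝ}

theorem eLpNorm_two_le_iff {V : Type*} [NormedAddCommGroup V] (g : Ω → V) (a : ℝ≥0∞) :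
    eLpNorm g 2 P ≤ a ↔ ∫⁻ ω, ‖g ω‖ₑ ^ 2 ∂P ≤ a ^ 2 := by
  rw [eLpNorm_eq_lintegral_rpow_enorm_toReal two_ne_zero ENNReal.ofNat_ne_top,
    one_div, ENNReal.rpow_inv_le_iff (by norm_num)]
  simp

theorem MeanSquareBound.eLpNorm_le (h : MeanSquareBound P T r) (f : F) :
    eLpNorm (fun ω => T ω f) 2 P ≤ ENNReal.ofReal (r * ‖f‖) := by
  rw [eLpNorm_two_le_iff, ENNReal.ofReal_mul h.nonneg, mul_pow, ofReal_norm]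
  exact h.lintegral_le f

theorem MeanSquareBound.memLp (h : MeanSquareBound P T r) (f : F) :
    MemLp (fun ω => T ω f) 2 P :=
  ⟨(h.stronglyMeasurable f).aestronglyMeasurable,
    (h.eLpNorm_le f).trans_lt ENNReal.ofReal_lt_top⟩

/-- A random operator with finite mean square size, as an operator into `L²`. -/
noncomputable def MeanSquareBound.toL2 (h : MeanSquareBound P T r) : F →L[ℝ] Lp G 2 P :=
  LinearMap.mkContinuous
    { toFun := fun f => (h.memLp f).toLp _
      map_add' := fun f g => by
        rw [← MemLp.toLp_add]
        congr 1
        funext ω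
        simp
      map_smul' := fun c f => by
        rw [RingHom.id_apply, ← MemLp.toLp_const_smul]
        congr 1
        funext ω
        simp } r fun f => by
    rw [LinearMap.coe_mk, AddHom.coe_mk, Lp.norm_toLp]
    exact ENNReal.toReal_le_of_le_ofReal (mul_nonneg h.nonneg (norm_nonneg f)) (h.eLpNorm_le f)

theorem MeanSquareBound.norm_toL2_le (h : MeanSquareBound P T r) : ‖h.toL2‖ ≤ r :=
  LinearMap.mkContinuous_norm_le _ h.nonneg _

theorem MeanSquareBound.inner_toL2_ae (h : MeanSquareBound P T r) (f g : F) :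
    (fun ω => inner ℝ (h.toL2 f ω) (h.toL2 g ω)) =ᵐ[P] fun ω => inner ℝ (T ω f) (T ω g) := by
  filter_upwards [(h.memLp f).coeFn_toLp, (h.memLp g).coeFn_toLp] with ω h1 h2
  change inner ℝ ((h.memLp f).toLp _ ω) ((h.memLp g).toLp _ ω) = _
  rw [h1, h2]

theorem MeanSquareBound.inner_toL2 (h : MeanSquareBound P T r) (f g : F) :
    inner ℝ (h.toL2 f) (h.toL2 g) = ∫ ω, inner ℝ (T ω f) (T ω g) ∂P := by
  rw [L2.inner_def]
  exact integral_congr_ae (h.inner_toL2_ae f g)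

theorem MeanSquareBound.integrable_inner (h : MeanSquareBound P T r) (f g : F) :
    Integrable (fun ω => inner ℝ (T ω f) (T ω g)) P :=
  (L2.integrable_inner (𝕜 := ℝ) (h.toL2 f) (h.toL2 g)).congr (h.inner_toL2_ae f g)

end

variable [∀ i, MeasurableSpace (Ω i)] {P : ∀ i, Measure (Ω i)} [∀ i, IsProbabilityMeasure (P i)]
  {T : ∀ i, Ω i → F i →L[ℝ] G i} {r : ι → ℝ}

/-- The norm in terms of the entrywise product of the Gram matrices of the factors. -/
theorem norm_sq_algTensorOp_sum (A : ∀ i, F i →L[ℝ] G i) {n : ℕ} (c : Fin n → ℝ)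
    (f : Fin n → ∀ i, F i) : ‖algTensorOp A (∑ a, c a • algProd (f a))‖ ^ 2
      = ∑ a, ∑ b, c a * c b * ∏ i, inner ℝ (A i (f a i)) (A i (f b i)) := by
  rw [← real_inner_self_eq_norm_sq, inner_algTensor]
  simp only [map_sum, map_smul, LinearMap.sum_apply, LinearMap.smul_apply, algTensorOp_algProd,
    tensorForm_algProd, smul_eq_mul, Finset.mul_sum]
  rw [Finset.sum_comm]
  refine Finset.sum_congr rfl fun a _ => Finset.sum_congr rfl fun b _ => ?_
  ring

/-- On the algebraic tensor product, independence turns the expectation of the products of Gram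
matrices into the product of their expectations, which are the Gram matrices of the operators into
`L²`. -/
theorem lintegral_algTensorOp_le (h : ∀ i, MeanSquareBound (P i) (T i) (r i)) (x : AlgTensor F) :
    Measurable (fun ω : ∀ i, Ω i => ‖algTensorOp (fun i => T i (ω i)) x‖ₑ) ∧
    ∫⁻ ω, ‖algTensorOp (fun i => T i (ω i)) x‖ₑ ^ 2 ∂Measure.pi P
      ≤ ENNReal.ofReal (∏ i, r i) ^ 2 * ‖x‖ₑ ^ 2 := by
  have hx := norm_algTensorOp_le (fun i => (h i).toL2) x
  obtain ⟨n, c, f, rfl⟩ := exists_eq_sum_algProd x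
  set x := ∑ a, c a • algProd (f a) with hxdef
  have hint : ∀ a b, Integrable (fun ω : ∀ i, Ω i => c a * c b
      * ∏ i, inner ℝ (T i (ω i) (f a i)) (T i (ω i) (f b i))) (Measure.pi P) := fun a b =>
    (Integrable.fintype_prod_dep (f := fun i ω => inner ℝ (T i ω (f a i)) (T i ω (f b i)))
      fun i => (h i).integrable_inner (f a i) (f b i)).const_mul _
  have hmeas : ∀ i f, StronglyMeasurable fun ω : ∀ i, Ω i => T i (ω i) f := fun i f =>
    ((h i).stronglyMeasurable f).comp_measurable (measurable_pi_apply i)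
  have hsq : Measurable fun ω : ∀ i, Ω i => ‖algTensorOp (fun i => T i (ω i)) x‖ ^ 2 := by
    simp only [hxdef, norm_sq_algTensorOp_sum]
    refine Finset.measurable_sum _ fun a _ => Finset.measurable_sum _ fun b _ =>
      Measurable.const_mul (Finset.measurable_prod _ fun i _ => ?_) _
    exact ((hmeas i (f a i)).inner (hmeas i (f b i))).measurable
  have hm : Measurable fun ω : ∀ i, Ω i => ‖algTensorOp (fun i => T i (ω i)) x‖ := by
    simpa [Real.sqrt_sq] using hsq.sqrt
  refine ⟨by simpa only [ofReal_norm] using hm.ennreal_ofReal, ?_⟩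
  have e1 : ∀ ω : ∀ i, Ω i, ‖algTensorOp (fun i => T i (ω i)) x‖ₑ ^ 2
      = ENNReal.ofReal (‖algTensorOp (fun i => T i (ω i)) x‖ ^ 2) := fun ω => by
    rw [ENNReal.ofReal_pow (norm_nonneg _), ofReal_norm]
  have e2 : ∫ ω, ‖algTensorOp (fun i => T i (ω i)) x‖ ^ 2 ∂Measure.pi P
      = ‖algTensorOp (fun i => (h i).toL2) x‖ ^ 2 := by
    simp only [hxdef, norm_sq_algTensorOp_sum]
    rw [integral_finsetSum _ fun a _ => integrable_finsetSum _ fun b _ => hint a b]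
    refine Finset.sum_congr rfl fun a _ => ?_
    rw [integral_finsetSum _ fun b _ => hint a b]
    refine Finset.sum_congr rfl fun b _ => ?_
    rw [integral_const_mul, integral_fintype_prod_eq_prod
      (fun i ω => inner ℝ (T i ω (f a i)) (T i ω (f b i)))]
    simp only [MeanSquareBound.inner_toL2]
  have hI : Integrable (fun ω : ∀ i, Ω i => ‖algTensorOp (fun i => T i (ω i)) x‖ ^ 2)
      (Measure.pi P) := by
    simp only [hxdef, norm_sq_algTensorOp_sum]
    exact integrable_finsetSum _ fun a _ => integrable_finsetSum _ fun b _ => hint a b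
  simp only [e1]
  rw [← ofReal_integral_eq_lintegral_ofReal hI (ae_of_all _ fun _ => by positivity), e2,
    ← ofReal_norm x, ← mul_pow, ← ENNReal.ofReal_mul (Finset.prod_nonneg fun i _ => (h i).nonneg),
    ← ENNReal.ofReal_pow (mul_nonneg (Finset.prod_nonneg fun i _ => (h i).nonneg) (norm_nonneg _))]
  gcongr
  exact hx.trans (mul_le_mul_of_nonneg_right
    (Finset.prod_le_prod (fun _ _ => norm_nonneg _) fun i _ => (h i).norm_toL2_le) (norm_nonneg _))

/-- The mean square size of a tensor product of independent random operators is at most the product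
of the sizes. The passage to the completion is by Fatou's lemma. -/
theorem lintegral_tensorOp_le (h : ∀ i, MeanSquareBound (P i) (T i) (r i)) (x : HilbertTensor F) :
    Measurable (fun ω : ∀ i, Ω i => ‖tensorOp (fun i => T i (ω i)) x‖ₑ) ∧
    ∫⁻ ω, ‖tensorOp (fun i => T i (ω i)) x‖ₑ ^ 2 ∂Measure.pi P
      ≤ ENNReal.ofReal (∏ i, r i) ^ 2 * ‖x‖ₑ ^ 2 := by
  obtain ⟨y, hy, hyx⟩ := mem_closure_iff_seq_limit.1
    (UniformSpace.Completion.denseRange_coe (α := AlgTensor F) x)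
  choose z hz using hy
  have hzx : Filter.Tendsto (fun k => ((z k : AlgTensor F) : HilbertTensor F)) Filter.atTop
      (nhds x) := by
    simpa only [hz] using hyx
  have hlim : ∀ ω : ∀ i, Ω i, Filter.Tendsto
      (fun k => ‖algTensorOp (fun i => T i (ω i)) (z k)‖ₑ) Filter.atTop
      (nhds ‖tensorOp (fun i => T i (ω i)) x‖ₑ) := fun ω => by
    have := ((tensorOp fun i => T i (ω i)).continuous.tendsto x).comp hzx |>.enorm
    simpa only [Function.comp_def, tensorOp_coe, ← ofReal_norm, UniformSpace.Completion.norm_coe]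
      using this
  have hm := fun k => lintegral_algTensorOp_le h (z k)
  refine ⟨measurable_of_tendsto_metrizable (fun k => (hm k).1) (tendsto_pi_nhds.2 hlim), ?_⟩
  have hn : Filter.Tendsto (fun k => ENNReal.ofReal (∏ i, r i) ^ 2 * ‖z k‖ₑ ^ 2) Filter.atTop
      (nhds (ENNReal.ofReal (∏ i, r i) ^ 2 * ‖x‖ₑ ^ 2)) := by
    refine ENNReal.Tendsto.const_mul ?_ (Or.inr (by finiteness))
    have := ((ENNReal.continuous_pow 2).tendsto _).comp hzx.enorm
    simpa only [Function.comp_def, ← ofReal_norm, UniformSpace.Completion.norm_coe] using this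
  calc ∫⁻ ω, ‖tensorOp (fun i => T i (ω i)) x‖ₑ ^ 2 ∂Measure.pi P
      = ∫⁻ ω, Filter.liminf (fun k => ‖algTensorOp (fun i => T i (ω i)) (z k)‖ₑ ^ 2)
          Filter.atTop ∂Measure.pi P :=
        lintegral_congr fun ω =>
          ((((ENNReal.continuous_pow 2).tendsto _).comp (hlim ω)).liminf_eq).symm
    _ ≤ Filter.liminf (fun k => ∫⁻ ω, ‖algTensorOp (fun i => T i (ω i)) (z k)‖ₑ ^ 2
          ∂Measure.pi P) Filter.atTop := lintegral_liminf_le fun k => (hm k).1.pow_const 2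
    _ ≤ Filter.liminf (fun k => ENNReal.ofReal (∏ i, r i) ^ 2 * ‖z k‖ₑ ^ 2) Filter.atTop :=
        Filter.liminf_le_liminf (Filter.Eventually.of_forall fun k => (hm k).2)
    _ = _ := hn.liminf_eq

end TensorSize

/-! ### The error of the Smolyak method -/

section Size

variable {Ω : Type*} [MeasurableSpace Ω] {F G : Type*} [NormedAddCommGroup F]
  [InnerProductSpace ℝ F] [NormedAddCommGroup G] [InnerProductSpace ℝ G] {P : Measure Ω}

/-- The `L²` norm of the (possibly non-measurable) function `g` is at most `r`, with a measurable
majorant of `g` as a witness. -/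
def L2Majorized (P : Measure Ω) (g : Ω → ℝ≥0∞) (r : ℝ) : Prop :=
  ∃ h : Ω → ℝ≥0∞, Measurable h ∧ (∀ ω, g ω ≤ h ω) ∧ ∫⁻ ω, h ω ^ 2 ∂P ≤ ENNReal.ofReal r ^ 2

theorem sqrt_le_iff (a b : ℝ≥0∞) : a ^ (1 / 2 : ℝ) ≤ b ↔ a ≤ b ^ 2 := by
  rw [one_div, ENNReal.rpow_inv_le_iff (by norm_num), ENNReal.rpow_two]

theorem L2Majorized.add {g g' k : Ω → ℝ≥0∞} {r r' : ℝ} (hr : 0 ≤ r) (hr' : 0 ≤ r')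
    (h : L2Majorized P g r) (h' : L2Majorized P g' r') (hk : ∀ ω, k ω ≤ g ω + g' ω) :
    L2Majorized P k (r + r') := by
  obtain ⟨u, hu, hgu, hui⟩ := h
  obtain ⟨u', hu', hgu', hui'⟩ := h'
  refine ⟨u + u', hu.add hu', fun ω => (hk ω).trans (add_le_add (hgu ω) (hgu' ω)), ?_⟩
  rw [ENNReal.ofReal_add hr hr', ← sqrt_le_iff]
  have := ENNReal.lintegral_Lp_add_le (p := 2) (μ := P) hu.aemeasurable hu'.aemeasurable
    (by norm_num)
  simp only [ENNReal.rpow_two] at this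
  exact this.trans (add_le_add ((sqrt_le_iff _ _).2 hui) ((sqrt_le_iff _ _).2 hui'))

theorem L2Majorized.lintegral_le {g : Ω → ℝ≥0∞} {r : ℝ} (h : L2Majorized P g r) :
    ∫⁻ ω, g ω ^ 2 ∂P ≤ ENNReal.ofReal r ^ 2 := by
  obtain ⟨u, hu, hgu, hui⟩ := h
  refine (lintegral_mono fun ω => ?_).trans hui
  have := hgu ω
  gcongr

theorem L2Majorized.mono {g : Ω → ℝ≥0∞} {r s : ℝ} (hrs : r ≤ s) (h : L2Majorized P g r) :
    L2Majorized P g s := by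
  obtain ⟨u, hu, hgu, hui⟩ := h
  exact ⟨u, hu, hgu, hui.trans (by gcongr)⟩

theorem L2Majorized.zero {g : Ω → ℝ≥0∞} {r : ℝ} (hg : ∀ ω, g ω = 0) : L2Majorized P g r :=
  ⟨0, measurable_zero, fun ω => (hg ω).le, by simp⟩

/-- The measurable random operator `T` has size at most `r` with respect to the criterion `x`. -/
def SizeLE (x : Criterion) (P : Measure Ω) (T : Ω → F →L[ℝ] G) (r : ℝ) : Prop :=
  match x with
  | .ran => MeanSquareBound P T r
  | .wor => 0 ≤ r ∧ Measurable (fun ω => ‖T ω‖ₑ) ∧ ∫⁻ ω, ‖T ω‖ₑ ^ 2 ∂P ≤ ENNReal.ofReal r ^ 2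

/-- A bound `r` of the size of a random operator that makes sense without measurability, and that
is subadditive nevertheless. -/
def MajorizedSizeLE (x : Criterion) (P : Measure Ω) (T : Ω → F →L[ℝ] G) (r : ℝ) : Prop :=
  0 ≤ r ∧ match x with
  | .ran => ∀ f : F, ‖f‖ ≤ 1 → L2Majorized P (fun ω => ‖T ω f‖ₑ) r
  | .wor => L2Majorized P (fun ω => ‖T ω‖ₑ) r

theorem MajorizedSizeLE.zero (x : Criterion) {r : ℝ} (hr : 0 ≤ r) :
    MajorizedSizeLE x P (0 : Ω → F →L[ℝ] G) r := by
  refine ⟨hr, ?_⟩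
  cases x
  · exact fun f _ => L2Majorized.zero fun ω => by simp
  · exact L2Majorized.zero fun ω => by simp [← ofReal_norm]

theorem MajorizedSizeLE.add {x : Criterion} {T T' : Ω → F →L[ℝ] G} {r r' : ℝ}
    (h : MajorizedSizeLE x P T r) (h' : MajorizedSizeLE x P T' r') :
    MajorizedSizeLE x P (T + T') (r + r') := by
  refine ⟨add_nonneg h.1 h'.1, ?_⟩
  cases x
  · exact fun f hf => (h.2 f hf).add h.1 h'.1 (h'.2 f hf) fun ω => enorm_add_le _ _
  · exact h.2.add h.1 h'.1 h'.2 fun ω => by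
      rw [← ofReal_norm, ← ofReal_norm, ← ofReal_norm,
        ← ENNReal.ofReal_add (norm_nonneg _) (norm_nonneg _)]
      exact ENNReal.ofReal_le_ofReal (norm_add_le (T ω) (T' ω))

theorem MajorizedSizeLE.mono {x : Criterion} {T : Ω → F →L[ℝ] G} {r s : ℝ} (hrs : r ≤ s)
    (h : MajorizedSizeLE x P T r) : MajorizedSizeLE x P T s := by
  refine ⟨h.1.trans hrs, ?_⟩
  cases x
  · exact fun f hf => (h.2 f hf).mono hrs
  · exact h.2.mono hrs

theorem MajorizedSizeLE.ranSize_le {x : Criterion} {T : Ω → F →L[ℝ] G} {r : ℝ}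
    (h : MajorizedSizeLE x P T r) : ranSize x P T ≤ ENNReal.ofReal r := by
  cases x
  · exact iSup₂_le fun f hf => (sqrt_le_iff _ _).2 (h.2 f hf).lintegral_le
  · refine (sqrt_le_iff _ _).2 ((lintegral_mono fun ω => ?_).trans h.2.lintegral_le)
    refine iSup₂_le fun f hf => ?_
    have : ‖T ω f‖ₑ ≤ ‖T ω‖ₑ := by
      rw [enorm_le_iff_norm_le]
      exact (T ω).unit_le_opNorm f hf
    gcongr

/-- By separability, the operator norm is determined by countably many measurable functions. -/
theorem measurable_enorm_of_separable [TopologicalSpace.SeparableSpace F] {T : Ω → F →L[ℝ] G}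
    (hT : ∀ f, StronglyMeasurable fun ω => T ω f) : Measurable fun ω => ‖T ω‖ₑ := by
  have h : Measurable fun ω => ‖T ω‖ := by
    refine measurable_of_Iic fun c => ?_
    rcases lt_or_ge c 0 with hc | hc
    · convert MeasurableSet.empty
      ext ω
      simpa using hc.trans_le (norm_nonneg (T ω))
    · have e : (fun ω => ‖T ω‖) ⁻¹' Set.Iic c = ⋂ k,
          {ω | ‖T ω (TopologicalSpace.denseSeq F k)‖ ≤ c * ‖TopologicalSpace.denseSeq F k‖} := by
        ext ω
        simp only [Set.mem_preimage, Set.mem_Iic, Set.mem_iInter, Set.mem_ofPred_eq]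
        refine ⟨fun h k => (T ω).le_of_opNorm_le h _, fun h => ?_⟩
        refine (T ω).opNorm_le_bound hc fun f => ?_
        have hcl : IsClosed {f | ‖T ω f‖ ≤ c * ‖f‖} :=
          isClosed_le (by fun_prop) (by fun_prop)
        exact (TopologicalSpace.denseRange_denseSeq F).induction_on f hcl h
      rw [e]
      exact MeasurableSet.iInter fun k => measurableSet_le (hT _).norm.measurable
        measurable_const
  simpa only [ofReal_norm] using h.ennreal_ofReal

theorem enorm_sq_le_iSup (A : F →L[ℝ] G) : ‖A‖ₑ ^ 2 ≤ ⨆ (f : F) (_ : ‖f‖ ≤ 1), ‖A f‖ₑ ^ 2 := by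
  set s := ⨆ (f : F) (_ : ‖f‖ ≤ 1), ‖A f‖ₑ ^ 2 with hs
  rcases eq_or_ne s ⊤ with h | h
  · simp [h]
  have h1 : ∀ f : F, ‖f‖ ≤ 1 → ‖A f‖ ≤ √s.toReal := fun f hf => by
    have : ‖A f‖ₑ ^ 2 ≤ s := le_iSup₂ (f := fun (f : F) (_ : ‖f‖ ≤ 1) => ‖A f‖ₑ ^ 2) f hf
    refine Real.le_sqrt_of_sq_le ?_
    have := ENNReal.toReal_mono h this
    simpa using this
  have h2 : ‖A‖ ≤ √s.toReal :=
    ContinuousLinearMap.opNorm_le_of_unit_norm (Real.sqrt_nonneg _) fun f hf => h1 f hf.le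
  have h3 : ‖A‖ ^ 2 ≤ s.toReal := by
    calc ‖A‖ ^ 2 ≤ √s.toReal ^ 2 := by gcongr
      _ = _ := Real.sq_sqrt ENNReal.toReal_nonneg
  calc ‖A‖ₑ ^ 2 = ENNReal.ofReal (‖A‖ ^ 2) := by
        rw [ENNReal.ofReal_pow (norm_nonneg _), ofReal_norm]
    _ ≤ ENNReal.ofReal s.toReal := by gcongr
    _ = s := ENNReal.ofReal_toReal h

theorem sizeLE_of_ranSize_le [TopologicalSpace.SeparableSpace F] (x : Criterion)
    {T : Ω → F →L[ℝ] G} {r : ℝ} (hr : 0 ≤ r) (hT : ∀ f, StronglyMeasurable fun ω => T ω f)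
    (h : ranSize x P T ≤ ENNReal.ofReal r) : SizeLE x P T r := by
  cases x
  · refine ⟨hr, hT, fun f => ?_⟩
    rcases eq_or_ne f 0 with rfl | hf
    · simp
    have hf' : ‖f‖ ≠ 0 := norm_ne_zero_iff.2 hf
    have h1 : ∫⁻ ω, ‖T ω (‖f‖⁻¹ • f)‖ₑ ^ 2 ∂P ≤ ENNReal.ofReal r ^ 2 := by
      rw [← sqrt_le_iff]
      refine le_trans (le_iSup₂ (f := fun (f : F) (_ : ‖f‖ ≤ 1) =>
        (∫⁻ ω, ‖T ω f‖ₑ ^ 2 ∂P) ^ (1 / 2 : ℝ)) (‖f‖⁻¹ • f) ?_) h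
      rw [norm_smul, norm_inv, norm_norm, inv_mul_cancel₀ hf']
    have h2 : ∀ ω, ‖T ω f‖ₑ ^ 2 = ‖f‖ₑ ^ 2 * ‖T ω (‖f‖⁻¹ • f)‖ₑ ^ 2 := fun ω => by
      rw [← mul_pow]
      congr 1
      rw [← ofReal_norm, ← ofReal_norm, ← ofReal_norm, ← ENNReal.ofReal_mul (norm_nonneg _),
        map_smul, norm_smul, norm_inv, norm_norm, mul_inv_cancel_left₀ hf']
    simp only [h2]
    rw [lintegral_const_mul' _ _ (by finiteness), mul_comm]
    gcongr
  · refine ⟨hr, measurable_enorm_of_separable hT, ?_⟩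
    exact (lintegral_mono fun ω => enorm_sq_le_iSup (T ω)).trans ((sqrt_le_iff _ _).1 h)

theorem sizeLE_const [IsProbabilityMeasure P] (x : Criterion) {A : F →L[ℝ] G} {r : ℝ}
    (h : ‖A‖ ≤ r) : SizeLE x P (fun _ => A) r := by
  have hr := (norm_nonneg A).trans h
  cases x
  · refine ⟨hr, fun f => stronglyMeasurable_const, fun f => ?_⟩
    rw [lintegral_const, measure_univ, mul_one, ← mul_pow, ← ofReal_norm f,
      ← ENNReal.ofReal_mul hr, ← ofReal_norm]
    have := A.le_of_opNorm_le h f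
    gcongr
  · refine ⟨hr, measurable_const, ?_⟩
    rw [lintegral_const, measure_univ, mul_one, ← ofReal_norm]
    gcongr

end Size

section Error

/-- The size of a tensor product of independent random operators is at most the product of the
sizes. -/
theorem majorizedSizeLE_tensorOp {ι : Type*} [Fintype ι] {Ω F G : ι → Type*}
    [∀ i, NormedAddCommGroup (F i)] [∀ i, InnerProductSpace ℝ (F i)]
    [∀ i, NormedAddCommGroup (G i)] [∀ i, InnerProductSpace ℝ (G i)]
    [∀ i, MeasurableSpace (Ω i)] (P : ∀ i, Measure (Ω i)) [∀ i, IsProbabilityMeasure (P i)]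
    (x : Criterion) (T : ∀ i, Ω i → F i →L[ℝ] G i) (r : ι → ℝ)
    (h : ∀ i, SizeLE x (P i) (T i) (r i)) :
    MajorizedSizeLE x (Measure.pi P) (tensorOpMultilinear Ω F G T) (∏ i, r i) := by
  cases x
  · refine ⟨Finset.prod_nonneg fun i _ => (h i).nonneg, fun f hf => ?_⟩
    obtain ⟨h1, h2⟩ := lintegral_tensorOp_le h f
    refine ⟨_, h1, fun ω => le_rfl, h2.trans ?_⟩
    have : ‖f‖ₑ ≤ 1 := by
      rw [← ofReal_norm]
      exact ENNReal.ofReal_le_one.2 hf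
    exact mul_le_of_le_one_right' (pow_le_one' this 2)
  · refine ⟨Finset.prod_nonneg fun i _ => (h i).1, fun ω => ∏ i, ‖T i (ω i)‖ₑ, ?_, fun ω => ?_, ?_⟩
    · exact Finset.measurable_prod _ fun i _ => (h i).2.1.comp (measurable_pi_apply i)
    · exact enorm_tensorOp_le _
    · simp only [← Finset.prod_pow]
      rw [lintegral_pi_prod P (fun i ω => ‖T i ω‖ₑ ^ 2) fun i => (h i).2.1.pow_const 2,
        ENNReal.ofReal_prod_of_nonneg fun i _ => (h i).1, ← Finset.prod_pow]
      exact Finset.prod_le_prod' fun i _ => (h i).2.2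

variable {d : ℕ} {Ω : Fin d → Type*} [∀ n, MeasurableSpace (Ω n)]
  {F : Fin d → Type*} [∀ n, NormedAddCommGroup (F n)] [∀ n, InnerProductSpace ℝ (F n)]
  {G : Fin d → Type*} [∀ n, NormedAddCommGroup (G n)] [∀ n, InnerProductSpace ℝ (G n)]
  {Λ : ∀ n, Set (StrongDual ℝ (F n))}

theorem block_of_pos {Ω : Type*} [MeasurableSpace Ω] {F G : Type*} [NormedAddCommGroup F]
    [InnerProductSpace ℝ F] [NormedAddCommGroup G] [InnerProductSpace ℝ G]
    {Λ : Set (StrongDual ℝ F)} (U : ℕ → RanLinAlg Ω G Λ) {l : ℕ} (hl : 1 ≤ l) :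
    block U l = U l := by
  obtain ⟨k, rfl⟩ : ∃ k, l = k + 1 := ⟨l - 1, by omega⟩
  rfl

/-- The differences telescope, starting from `U 0 = 0`. -/
theorem sum_delta {Ω : Type*} [MeasurableSpace Ω] {F G : Type*} [NormedAddCommGroup F]
    [InnerProductSpace ℝ F] [NormedAddCommGroup G] [InnerProductSpace ℝ G]
    {Λ : Set (StrongDual ℝ F)} (U : ℕ → RanLinAlg Ω G Λ) (l : ℕ) :
    ∑ a ∈ Finset.Icc 1 l, delta U a = (block U l).op := by
  induction l with
  | zero => rfl
  | succ l ih =>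
    rw [Finset.sum_Icc_succ_top (by omega), ih]
    funext ω
    simp [delta]

/-- The error bound in terms of the level `L`. -/
theorem err_smolyak_le [∀ n, TopologicalSpace.SeparableSpace (F n)] {x : Criterion}
    {P : ∀ n, Measure (Ω n)} [∀ n, IsProbabilityMeasure (P n)] {S : ∀ n, F n →L[ℝ] G n}
    {U : ∀ n, ℕ → RanLinAlg (Ω n) (G n) (Λ n)} {B C D E : ℝ} (hB : 0 ≤ B) (hC : 0 ≤ C)
    (hD : 0 < D) (hE : 0 ≤ E) (h : ErrorBounds x P S U B C D E) (hd : d ≠ 0) {L : ℕ} (hL : d ≤ L) :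
    err x (Measure.pi P) (tensorOp S) (smolyak U L)
      ≤ ENNReal.ofReal (C * D ^ L * (L - 1).choose (d - 1) * (E + B / D) ^ (d - 1)) := by
  have hdelta : ∀ n l, 1 ≤ l → SizeLE x (P n) (delta (U n) l) (E * D ^ l) := fun n l hl => by
    have h1 : ∀ f, StronglyMeasurable fun ω => delta (U n) l ω f := fun f =>
      ((block (U n) l).stronglyMeasurable_op f).sub
        ((block (U n) (l - 1)).stronglyMeasurable_op f)
    have h2 : 0 ≤ E * D ^ l := by positivity
    have h3 := h.delta_le n l hl
    exact sizeLE_of_ranSize_le x h2 h1 h3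
  have herr : ∀ n l, 1 ≤ l → SizeLE x (P n)
      ((fun _ => S n) - ∑ a ∈ Finset.Icc 1 l, delta (U n) a) (C * D ^ l) := fun n l hl => by
    rw [sum_delta, block_of_pos _ hl]
    refine sizeLE_of_ranSize_le x (by positivity) (fun f => ?_) (h.err_le n l hl)
    exact stronglyMeasurable_const.sub ((U n l).stronglyMeasurable_op f)
  have hM : ∀ (T : ∀ n, Ω n → F n →L[ℝ] G n) (r : Fin d → ℝ), (∀ n, SizeLE x (P n) (T n) (r n)) →
      MajorizedSizeLE x (Measure.pi P) (tensorOpMultilinear Ω F G T) (1 * ∏ n, r n) :=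
    fun T r hT => by simpa only [one_mul] using majorizedSizeLE_tensorOp P x T r hT
  have hS := fun n => sizeLE_const (P := P n) x (h.norm_le n)
  have key := size_sub_sum_levels
    (MajorizedSizeLE (F := HilbertTensor F) (G := HilbertTensor G) x (Measure.pi P))
    (fun r hr => MajorizedSizeLE.zero x hr) (fun _ _ _ _ h h' => h.add h')
    (fun _ _ _ hrs h => h.mono hrs) hB hC hD hE d (fun n => Ω n → F n →L[ℝ] G n)
    (fun n => SizeLE x (P n)) (tensorOpMultilinear Ω F G) 1 zero_le_one hM
    (fun n _ => S n) (fun n => delta (U n)) hS herr hdelta L hL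
  rw [one_mul, if_neg hd] at key
  have e : (fun ω => tensorOp S - smolyak U L ω)
      = tensorOpMultilinear Ω F G (fun n _ => S n)
        - ∑ l ∈ levels L d, tensorOpMultilinear Ω F G fun n => delta (U n) (l n) := by
    funext ω
    simp only [Pi.sub_apply, Finset.sum_apply]
    rfl
  rw [err, e]
  exact key.ranSize_le

end Error

/-! ### The cost of the Smolyak method -/

section Cost

/-- There are `(s - 1).choose d ≤ (L - 1).choose d` multi-indices `l` with `|l| = s ≤ L`, which
leaves a geometric sum. The proof peels off the first coordinate instead. -/
theorem sum_levels_pow_le {K : ℝ} (hK : 1 < K) (d : ℕ) : ∀ L : ℕ,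
    ∑ l ∈ levels L (d + 1), K ^ (∑ n, l n) ≤ K / (K - 1) * (L - 1).choose d * K ^ L := by
  have hK1 : 0 < K - 1 := by linarith
  have hsucc : ∀ d L, ∑ l ∈ levels L (d + 1), K ^ (∑ n, l n)
      = ∑ a ∈ Finset.Icc 1 (L - d), K ^ a * ∑ l ∈ levels (L - a) d, K ^ (∑ n, l n) := by
    intro d L
    rw [sum_levels_succ]
    simp only [Fin.sum_univ_succ, Fin.cons_zero, Fin.cons_succ, pow_add, Finset.mul_sum]
  induction d with
  | zero =>
    intro L
    rw [hsucc]
    simp only [levels_zero, Finset.sum_singleton, Finset.univ_eq_empty, Finset.sum_empty, pow_zero,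
      mul_one, Nat.choose_zero_right, Nat.cast_one, Nat.sub_zero]
    induction L with
    | zero => simpa using by positivity
    | succ L ih =>
      rw [Finset.sum_Icc_succ_top (by omega)]
      have e : K / (K - 1) * K ^ (L + 1) = K / (K - 1) * K ^ L + K ^ (L + 1) := by
        field_simp
        ring
      linarith
  | succ d ih =>
    intro L
    rw [hsucc, ← sum_choose_sub, Nat.cast_sum, Finset.mul_sum, Finset.sum_mul]
    refine Finset.sum_le_sum fun a ha => ?_
    rw [Finset.mem_Icc] at ha
    calc K ^ a * ∑ l ∈ levels (L - a) (d + 1), K ^ (∑ n, l n)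
        ≤ K ^ a * (K / (K - 1) * (L - a - 1).choose d * K ^ (L - a)) := by
          gcongr
          exact ih _
      _ = K / (K - 1) * (L - a - 1).choose d * K ^ L := by
          rw [show K ^ L = K ^ a * K ^ (L - a) by rw [← pow_add]; congr 1; omega]
          ring

variable {d : ℕ} {Ω : Fin d → Type*} [∀ n, MeasurableSpace (Ω n)]
  {F : Fin d → Type*} [∀ n, NormedAddCommGroup (F n)] [∀ n, InnerProductSpace ℝ (F n)]
  {G : Fin d → Type*} [∀ n, NormedAddCommGroup (G n)] [∀ n, InnerProductSpace ℝ (G n)]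
  {Λ : ∀ n, Set (StrongDual ℝ (F n))} {P : ∀ n, Measure (Ω n)}
  {U : ∀ n, ℕ → RanLinAlg (Ω n) (G n) (Λ n)} {Klow Kup K : ℝ}

theorem ranCard_block_le (hKup : 0 ≤ Kup) (hK : 1 < K) (h : CostGrowth P U Klow Kup K)
    (n : Fin d) (l : ℕ) :
    ranCard (P n) (block (U n) l).info ≤ ENNReal.ofReal (Kup * K ^ l) := by
  -- The sharper bound `Kup * (K ^ l - 1)` telescopes.
  have key : ranCard (P n) (block (U n) l).info ≤ ENNReal.ofReal (Kup * (K ^ l - 1)) := by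
    induction l with
    | zero => simp [block, RanLinAlg.zero, ranCard]
    | succ l ih =>
      refine (h n (l + 1) (by omega)).2.trans ((add_le_add_left ih _).trans ?_)
      have h1 : 1 ≤ K ^ l := one_le_pow₀ hK.le
      rw [Nat.add_sub_cancel, ← ENNReal.ofReal_add
        (mul_nonneg hKup (by linarith))
        (mul_nonneg (mul_nonneg hKup (by positivity)) (by linarith))]
      refine ENNReal.ofReal_le_ofReal (le_of_eq ?_)
      ring
  refine key.trans (ENNReal.ofReal_le_ofReal ?_)
  gcongr
  linarith

theorem card_smolyakInfo_le [∀ n, CompleteSpace (F n)] (L : ℕ) (ω : ∀ n, Ω n) :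
    ((smolyakInfo U L ω).card : ℝ≥0∞)
      ≤ ∑ l ∈ levels L d, ∏ n, (((U n (l n)).info (ω n)).card : ℝ≥0∞) := by
  classical
  have h : (smolyakInfo U L ω).card
      ≤ ∑ l ∈ levels L d, ∏ n, ((U n (l n)).info (ω n)).card := by
    unfold smolyakInfo
    refine Finset.card_biUnion_le.trans ((Finset.sum_le_sum fun l _ =>
      Finset.card_image_le.trans (Fintype.card_piFinset _).le).trans ?_)
    exact Finset.sum_le_sum_of_subset (Finset.filter_subset _ _)
  exact_mod_cast h

/-- Counting functionals with multiplicity gives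
`N ≤ ∑_{|l| ≤ L} ∏ m_{l_n, n} ≤ Kup ^ d ∑_{|l| ≤ L} K ^ |l|`. -/
theorem ranCard_smolyakInfo_le [∀ n, CompleteSpace (F n)] [∀ n, IsProbabilityMeasure (P n)]
    (hKup : 0 ≤ Kup) (hK : 1 < K) (h : CostGrowth P U Klow Kup K) (L : ℕ) :
    ranCard (Measure.pi P) (smolyakInfo U L)
      ≤ ENNReal.ofReal (∑ l ∈ levels L d, Kup ^ d * K ^ (∑ n, l n)) := by
  have hm : ∀ n l, Measurable fun ω => (((U n l).info ω).card : ℝ≥0∞) := fun n l =>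
    measurable_from_top.comp (U n l).measurable_card
  have hK0 : 0 ≤ K := by linarith
  refine (lintegral_mono fun ω => card_smolyakInfo_le L ω).trans ?_
  rw [lintegral_finsetSum _ fun l _ => Finset.measurable_prod _ fun n _ =>
      (hm n (l n)).comp (measurable_pi_apply n),
    ENNReal.ofReal_sum_of_nonneg fun l _ => by positivity]
  refine Finset.sum_le_sum fun l hl => ?_
  rw [lintegral_pi_prod P (fun n ω => (((U n (l n)).info ω).card : ℝ≥0∞)) fun n => hm n (l n)]
  have e : Kup ^ d * K ^ (∑ n, l n) = ∏ n, Kup * K ^ l n := by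
    rw [Finset.prod_mul_distrib, Finset.prod_pow_eq_pow_sum]
    simp
  rw [e, ENNReal.ofReal_prod_of_nonneg fun n _ => by positivity]
  refine Finset.prod_le_prod' fun n _ => ?_
  have hl1 : 1 ≤ l n := by
    simp only [levels, Finset.mem_filter, Fintype.mem_piFinset, Finset.mem_Icc] at hl
    exact (hl.1 n).1
  have := ranCard_block_le hKup hK h n (l n)
  rwa [block_of_pos _ hl1] at this

/-- In dimension one some functional is used with positive probability. -/
theorem ranCard_smolyakInfo_ne_zero [∀ n, CompleteSpace (F n)] [∀ n, IsProbabilityMeasure (P n)]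
    (hKlow : 0 < Klow) (hK : 1 < K) (h : CostGrowth P U Klow Kup K) (hd : d = 1) {L : ℕ}
    (hL : d ≤ L) : ranCard (Measure.pi P) (smolyakInfo U L) ≠ 0 := by
  classical
  subst hd
  intro hN
  -- The measurable function `min (card info) 1` bounds the number of functionals from below, the
  -- measurability of which is not needed.
  have hm : Measurable fun ω => min (((U 0 L).info ω).card : ℝ≥0∞) 1 :=
    ((measurable_from_top (f := fun k : ℕ => (k : ℝ≥0∞))).comp
      (U 0 L).measurable_card).min measurable_const
  have hle : ∀ ω : ∀ n, Ω n,
      min (((U 0 L).info (ω 0)).card : ℝ≥0∞) 1 ≤ ((smolyakInfo U L ω).card : ℝ≥0∞) := by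
    intro ω
    rcases Finset.eq_empty_or_nonempty ((U 0 L).info (ω 0)) with h0 | ⟨ℓ, hℓ⟩
    · simp [h0]
    · refine (min_le_right _ _).trans ?_
      have hpos : 0 < (smolyakInfo U L ω).card := by
        refine Finset.card_pos.2 ⟨tensorFunctional (Fin.cons ℓ fun n => n.elim0), ?_⟩
        refine Finset.mem_biUnion.2 ⟨fun _ => L, ?_, Finset.mem_image_of_mem _ ?_⟩
        · simp [levels, hL]
        · rw [Fintype.mem_piFinset]
          intro n
          obtain rfl : n = 0 := Subsingleton.elim _ _
          exact hℓ
      exact_mod_cast hpos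
  have h0 : ∫⁻ ω, min (((U 0 L).info ω).card : ℝ≥0∞) 1 ∂P 0 = 0 := by
    rw [← (measurePreserving_eval P 0).lintegral_comp hm]
    exact le_antisymm ((lintegral_mono hle).trans hN.le) zero_le
  rw [lintegral_eq_zero_iff hm] at h0
  have h1 : ranCard (P 0) (block (U 0) L).info = 0 := by
    rw [block_of_pos _ hL, ranCard]
    refine (lintegral_congr_ae ?_).trans lintegral_zero
    filter_upwards [h0] with ω hω
    have : (((U 0 L).info ω).card : ℝ≥0∞) = 0 ∨ (1 : ℝ≥0∞) = 0 := by
      rcases min_choice (((U 0 L).info ω).card : ℝ≥0∞) 1 with h | h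
      · exact Or.inl (h.symm.trans hω)
      · exact Or.inr (h.symm.trans hω)
    simpa using this
  have h2 := (h 0 L hL).1
  rw [h1] at h2
  have h3 : 0 < ENNReal.ofReal (Klow * K ^ (L - 1) * (K - 1)) := by
    rw [ENNReal.ofReal_pos]
    have : 0 < K - 1 := by linarith
    positivity
  exact absurd (h3.trans_le (le_add_self.trans h2)) (lt_irrefl _)

end Cost

/-! ### Comparing the error and the cost -/

section Rate

open Real

/-- A binomial coefficient is dominated by a single term of the binomial theorem. -/
theorem choose_mul_pow_le {y : ℝ} (hy : 0 ≤ y) (m k : ℕ) :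
    (m.choose k : ℝ) * y ^ k ≤ (1 + y) ^ m := by
  rcases lt_or_ge m k with h | h
  · rw [Nat.choose_eq_zero_of_lt h]
    simp only [Nat.cast_zero, zero_mul]
    positivity
  · rw [add_comm, add_pow]
    have := Finset.single_le_sum (f := fun i => y ^ i * 1 ^ (m - i) * (m.choose i : ℝ))
      (fun i _ => by positivity) (Finset.mem_range.2 (Nat.lt_succ_of_le h))
    simpa [mul_comm] using this

/-- The case `y = k / m` of the bound by the binomial theorem. -/
theorem choose_le_exp_mul_div_pow (m k : ℕ) (hk : 0 < k) (hm : 0 < m) :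
    (m.choose k : ℝ) ≤ (exp 1 * (m / k)) ^ k := by
  have hk' : (0 : ℝ) < k := by exact_mod_cast hk
  have hm' : (0 : ℝ) < m := by exact_mod_cast hm
  have h := choose_mul_pow_le (y := (k / m : ℝ)) (by positivity) m k
  have h2 : (1 + k / m : ℝ) ^ m ≤ exp 1 ^ k := by
    calc (1 + k / m : ℝ) ^ m ≤ exp (k / m) ^ m := by
          gcongr
          rw [add_comm]
          exact add_one_le_exp _
      _ = exp 1 ^ k := by
          rw [← exp_nat_mul, ← exp_nat_mul]
          congr 1
          field_simp
  calc (m.choose k : ℝ) = m.choose k * (k / m : ℝ) ^ k * (m / k : ℝ) ^ k := by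
        rw [mul_assoc, ← mul_pow]
        field_simp
        simp
    _ ≤ exp 1 ^ k * (m / k : ℝ) ^ k := by
        gcongr
        exact h.trans h2
    _ = _ := (mul_pow _ _ _).symm

variable {D K α : ℝ}

/-- The rate `α` balances the growth `K` of the cost with the decay `D` of the error. -/
theorem rpow_alpha (hD : D ∈ Set.Ioo (0 : ℝ) 1) (hK : 1 < K) (hα : α = log (1 / D) / log K) :
    0 < α ∧ K ^ α = D⁻¹ := by
  have hlK : 0 < log K := log_pos hK
  have hlD : 0 < log (1 / D) := log_pos (by rw [lt_div_iff₀ hD.1]; linarith [hD.2])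
  refine ⟨hα ▸ div_pos hlD hlK, ?_⟩
  rw [rpow_def_of_pos (by linarith), hα, mul_div_cancel₀ _ hlK.ne',
    exp_log (by have := hD.1; positivity), one_div]

/-- The cost bound `N ≤ M K ^ L`, solved for the error `D ^ L`. -/
theorem pow_le_of_cost_le (hD : D ∈ Set.Ioo (0 : ℝ) 1) (hK : 1 < K)
    (hα : α = log (1 / D) / log K) {N M : ℝ} (hN : 0 < N) {L : ℕ} (h : N ≤ M * K ^ L) :
    D ^ L ≤ M ^ α * N ^ (-α) := by
  obtain ⟨hα0, hKα⟩ := rpow_alpha hD hK hα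
  have hKL : 0 < K ^ L := by positivity
  have hM : 0 ≤ M := by
    by_contra hM
    nlinarith [mul_neg_of_neg_of_pos (not_le.1 hM) hKL]
  have h1 : N ^ α ≤ M ^ α * (D ^ L)⁻¹ := by
    calc N ^ α ≤ (M * K ^ L) ^ α := rpow_le_rpow hN.le h hα0.le
      _ = M ^ α * (K ^ α) ^ L := by
          rw [mul_rpow hM hKL.le, ← rpow_natCast, ← rpow_natCast, ← rpow_mul (by linarith),
            ← rpow_mul (by linarith), mul_comm α]
      _ = _ := by rw [hKα, inv_pow]
  have hDL : 0 < D ^ L := pow_pos hD.1 _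
  rw [rpow_neg hN.le, ← div_eq_mul_inv, le_div_iff₀ (by positivity)]
  calc D ^ L * N ^ α ≤ D ^ L * (M ^ α * (D ^ L)⁻¹) := by gcongr
    _ = M ^ α := by field_simp

/-- If the cost `N` is at least `K ^ (m / 2)`, then `log N / k` controls the ratio `m / k`, and with
it the binomial coefficient. -/
theorem choose_le_of_le_log {κ N : ℝ} (hκ : 0 < κ) {m k : ℕ} (hk : 0 < k) (hm : 0 < m)
    (h : κ * m ≤ log N) : (m.choose k : ℝ) ≤ (exp 1 / κ * (1 + log N / k)) ^ k := by
  have hk' : (0 : ℝ) < k := by exact_mod_cast hk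
  refine (choose_le_exp_mul_div_pow m k hk hm).trans ?_
  have h1 : (m / k : ℝ) ≤ (1 + log N / k) / κ := by
    rw [le_div_iff₀ hκ, div_mul_eq_mul_div, mul_comm]
    have : κ * m / k ≤ log N / k := by gcongr
    linarith
  calc (exp 1 * (m / k : ℝ)) ^ k ≤ (exp 1 * ((1 + log N / k) / κ)) ^ k := by gcongr
    _ = _ := by ring

/-- If the cost `N` is at most `K ^ (m / 2)`, then `N ^ (-α)` is at least `D ^ (m / 2)`. -/
theorem sqrt_pow_le_of_log_le (hD : D ∈ Set.Ioo (0 : ℝ) 1) (hK : 1 < K)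
    (hα : α = log (1 / D) / log K) {N : ℝ} (hN : 0 < N) {m : ℕ}
    (h : log N ≤ log K / 2 * m) : √D ^ m ≤ N ^ (-α) := by
  have hlK : 0 < log K := log_pos hK
  have hα0 := (rpow_alpha hD hK hα).1
  have h1 : α * log K = -log D := by
    rw [hα, div_mul_cancel₀ _ hlK.ne', one_div, log_inv]
  have h2 : √D = exp (log D / 2) := by rw [exp_half, exp_log hD.1]
  rw [h2, ← exp_nat_mul, rpow_def_of_pos hN, exp_le_exp]
  have h3 := mul_le_mul_of_nonneg_left h hα0.le
  have h4 : α * (log K / 2 * m) = α * log K * (m / 2) := by ring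
  rw [h4, h1] at h3
  linarith

/-- Exponential decay in `m` compensates the binomial coefficient: the binomial theorem with
`1 + y = 1 / √D`. -/
theorem sqrt_pow_mul_choose_le (hD : D ∈ Set.Ioo (0 : ℝ) 1) (m k : ℕ) :
    √D ^ m * m.choose k ≤ (√D / (1 - √D)) ^ k := by
  have hr0 : 0 < √D := sqrt_pos.2 hD.1
  have hr1 : 0 < 1 - √D := sub_pos.2 ((sqrt_lt' one_pos).2 (by simpa using hD.2))
  have h := choose_mul_pow_le (y := (1 - √D) / √D) (by positivity) m k
  have e : 1 + (1 - √D) / √D = (√D)⁻¹ := by field_simp; ring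
  rw [e, inv_pow] at h
  have hy : 0 < ((1 - √D) / √D) ^ k := by positivity
  rw [← inv_div, inv_pow, ← one_div, le_div_iff₀ hy]
  calc √D ^ m * m.choose k * ((1 - √D) / √D) ^ k
      = √D ^ m * (m.choose k * ((1 - √D) / √D) ^ k) := by ring
    _ ≤ √D ^ m * (√D ^ m)⁻¹ := by gcongr
    _ = 1 := mul_inv_cancel₀ (by positivity)

/-- The base of the exponential factor in the error bound. -/
noncomputable def rateBase (D K α Kup H : ℝ) : ℝ :=
  Kup ^ α * ((1 + H) * ((1 + (exp 1 / (log K / 2)) ^ (1 + α)) * (1 + √D / (1 - √D))))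

/-- The error bound in terms of the cost, in dimension `k + 1` and with level `m + 1`. If the cost
is large, the binomial coefficient is bounded in terms of `log N`; if the cost is small, half of the
decay of `D ^ m` compensates the binomial coefficient, and the other half is at most `N ^ (-α)`. -/
theorem error_le_of_cost_le (hD : D ∈ Set.Ioo (0 : ℝ) 1) (hK : 1 < K)
    (hα : α = log (1 / D) / log K) {C Kup H N : ℝ} (hC : 0 < C) (hKup : 1 ≤ Kup) (hH : 0 ≤ H)
    (hN : 1 ≤ N) {m k : ℕ} (hk : 0 < k) (hkm : k ≤ m)
    (h : N ≤ Kup ^ (k + 1) * (K / (K - 1) * m.choose k * K ^ (m + 1))) :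
    C * D ^ (m + 1) * m.choose k * H ^ k
      ≤ C * (K / (K - 1)) ^ α * rateBase D K α Kup H ^ (k + 1)
          * (1 + log N / k) ^ ((k : ℝ) * (α + 1)) * N ^ (-α) := by
  obtain ⟨hα0, -⟩ := rpow_alpha hD hK hα
  have hN0 : 0 < N := by linarith
  have hK1 : 0 < K - 1 := by linarith
  have hr0 : 0 < √D := sqrt_pos.2 hD.1
  have hr1 : 0 < 1 - √D := sub_pos.2 ((sqrt_lt' one_pos).2 (by simpa using hD.2))
  have hκ : 0 < log K / 2 := half_pos (log_pos hK)
  have hQ : 1 ≤ 1 + log N / k := by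
    have := div_nonneg (log_nonneg hN) (Nat.cast_nonneg (α := ℝ) k)
    linarith
  have hb : (0 : ℝ) < m.choose k := by exact_mod_cast Nat.choose_pos hkm
  have hA : 1 ≤ Kup ^ α := one_le_rpow hKup hα0.le
  have hKK : 1 ≤ (K / (K - 1)) ^ α :=
    one_le_rpow ((one_le_div hK1).2 (by linarith)) hα0.le
  set X := (exp 1 / (log K / 2)) ^ (1 + α) with hX
  set Y := √D / (1 - √D) with hY
  have hX0 : 0 < X := by positivity
  have hY0 : 0 < Y := by positivity
  have hpow : ∀ z : ℝ, 0 ≤ z → z ^ k ≤ (1 + z) ^ (k + 1) := fun z hz => by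
    calc z ^ k ≤ (1 + z) ^ k := by gcongr; linarith
      _ ≤ (1 + z) ^ (k + 1) := pow_le_pow_right₀ (by linarith) (Nat.le_succ k)
  have hone : ∀ z : ℝ, 0 ≤ z → 1 ≤ (1 + z) ^ (k + 1) := fun z hz =>
    one_le_pow₀ (by linarith)
  have hbase : rateBase D K α Kup H ^ (k + 1) = (Kup ^ α) ^ (k + 1)
      * ((1 + H) ^ (k + 1) * ((1 + X) ^ (k + 1) * (1 + Y) ^ (k + 1))) := by
    simp only [rateBase, mul_pow, hX, hY]
  rw [hbase]
  set Q := (1 + log N / k) ^ ((k : ℝ) * (α + 1)) with hQdef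
  have hQ1 : 1 ≤ Q := one_le_rpow hQ (by positivity)
  rcases le_total (log K / 2 * m) (log N) with hcase | hcase
  · have hbin : (m.choose k : ℝ) ^ (1 + α) ≤ X ^ k * Q := by
      have h1 := choose_le_of_le_log hκ hk (by omega) hcase
      calc (m.choose k : ℝ) ^ (1 + α)
          ≤ ((exp 1 / (log K / 2) * (1 + log N / k)) ^ k) ^ (1 + α) :=
            rpow_le_rpow hb.le h1 (by linarith)
        _ = ((exp 1 / (log K / 2)) ^ (1 + α)) ^ k * (1 + log N / k) ^ ((k : ℝ) * (α + 1)) := by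
            rw [mul_pow, mul_rpow (by positivity) (by positivity)]
            congr 1
            · rw [← rpow_natCast, ← rpow_natCast, ← rpow_mul (by positivity),
                ← rpow_mul (by positivity), mul_comm]
            · rw [← rpow_natCast, ← rpow_mul (by positivity), add_comm 1 α]
    have hDL := pow_le_of_cost_le hD hK hα hN0 (L := m + 1)
      (M := Kup ^ (k + 1) * (K / (K - 1)) * m.choose k) (by linarith)
    rw [mul_rpow (by positivity) (by positivity), mul_rpow (by positivity) (by positivity),
      ← rpow_natCast Kup, ← rpow_mul (by positivity), mul_comm _ α, rpow_mul (by positivity),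
      rpow_natCast] at hDL
    calc C * D ^ (m + 1) * m.choose k * H ^ k
        ≤ C * ((Kup ^ α) ^ (k + 1) * (K / (K - 1)) ^ α * (m.choose k : ℝ) ^ α * N ^ (-α))
            * m.choose k * H ^ k := by gcongr
      _ = C * (K / (K - 1)) ^ α * ((Kup ^ α) ^ (k + 1) * (H ^ k * (m.choose k : ℝ) ^ (1 + α)))
            * N ^ (-α) := by
          rw [rpow_add hb, rpow_one]
          ring
      _ ≤ C * (K / (K - 1)) ^ α * ((Kup ^ α) ^ (k + 1) * ((1 + H) ^ (k + 1)
            * (((1 + X) ^ (k + 1) * (1 + Y) ^ (k + 1)) * Q))) * N ^ (-α) := by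
          gcongr
          · exact hpow H hH
          · refine hbin.trans ?_
            gcongr
            exact (hpow X hX0.le).trans (le_mul_of_one_le_right (by positivity) (hone Y hY0.le))
      _ = _ := by ring
  · have h1 := sqrt_pow_le_of_log_le hD hK hα hN0 hcase
    have h2 := sqrt_pow_mul_choose_le hD m k
    have h3 : D ^ (m + 1) ≤ √D ^ m * √D ^ m := by
      rw [← mul_pow, mul_self_sqrt hD.1.le]
      exact pow_le_pow_of_le_one hD.1.le hD.2.le (Nat.le_succ m)
    calc C * D ^ (m + 1) * m.choose k * H ^ k
        ≤ C * (√D ^ m * √D ^ m) * m.choose k * H ^ k := by gcongr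
      _ = C * (H ^ k * (√D ^ m * m.choose k)) * √D ^ m := by ring
      _ ≤ C * ((1 + H) ^ (k + 1) * (1 + Y) ^ (k + 1)) * N ^ (-α) := by
          gcongr
          · exact hpow H hH
          · exact h2.trans (hpow Y hY0.le)
      _ = C * 1 * (1 * ((1 + H) ^ (k + 1) * (1 * (1 + Y) ^ (k + 1)))) * 1 * N ^ (-α) := by ring
      _ ≤ _ := by
          gcongr
          · exact one_le_pow₀ hA
          · exact hone X hX0.le

end Rate

end Smolyak

theorem mainTheorem2 (x : Smolyak.Criterion) (B C D E Klow Kup K : ℝ)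
    (hB : 0 < B) (hC : 0 < C) (hE : 0 < E) (hD : D ∈ Set.Ioo (0 : ℝ) 1)
    (hKlow : 1 ≤ Klow) (hKup : Klow ≤ Kup) (hK : 1 < K)
    (α : ℝ) (hα : α = Real.log (1 / D) / Real.log K) :
    ∃ C₀ C₁ : ℝ, 0 < C₀ ∧ 0 < C₁ ∧
      ∀ (d : ℕ) (F : Fin d → Type*) [∀ n, NormedAddCommGroup (F n)]
        [∀ n, InnerProductSpace ℝ (F n)] [∀ n, CompleteSpace (F n)]
        [∀ n, TopologicalSpace.SeparableSpace (F n)]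
        (G : Fin d → Type*) [∀ n, NormedAddCommGroup (G n)]
        [∀ n, InnerProductSpace ℝ (G n)] [∀ n, CompleteSpace (G n)]
        [∀ n, TopologicalSpace.SeparableSpace (G n)]
        (Ω : Fin d → Type*) [∀ n, MeasurableSpace (Ω n)]
        (P : ∀ n, MeasureTheory.Measure (Ω n)) [∀ n, MeasureTheory.IsProbabilityMeasure (P n)]
        (S : ∀ n, F n →L[ℝ] G n) (Λ : ∀ n, Set (StrongDual ℝ (F n)))
        (U : ∀ n, ℕ → Smolyak.RanLinAlg (Ω n) (G n) (Λ n)),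
        Smolyak.ErrorBounds x P S U B C D E →
        Smolyak.CostGrowth P U Klow Kup K →
        ∀ (L : ℕ) (N : ENNReal), d ≤ L →
          N = Smolyak.ranCard (MeasureTheory.Measure.pi P) (Smolyak.smolyakInfo U L) →
          N ≠ ⊤ ∧
          (d = 1 →
            Smolyak.err x (MeasureTheory.Measure.pi P) (Smolyak.tensorOp S) (Smolyak.smolyak U L)
              ≤ ENNReal.ofReal (C₀ * C₁ * N.toReal ^ (-α))) ∧
          (2 ≤ d → 1 ≤ N →
            Smolyak.err x (MeasureTheory.Measure.pi P) (Smolyak.tensorOp S) (Smolyak.smolyak U L)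
              ≤ ENNReal.ofReal (C₀ * C₁ ^ d
                  * (1 + Real.log N.toReal / (d - 1)) ^ (((d : ℝ) - 1) * (α + 1))
                  * N.toReal ^ (-α))) := by
  have hD0 := hD.1
  have hKup1 : 1 ≤ Kup := hKlow.trans hKup
  have hK1 : 0 < K - 1 := by linarith
  have hH : 0 ≤ E + B / D := by positivity
  have hr1 : 0 < 1 - √D := sub_pos.2 ((Real.sqrt_lt' one_pos).2 (by simpa using hD.2))
  have hlK : 0 < Real.log K := Real.log_pos hK
  have hα0 := (Smolyak.rpow_alpha hD hK hα).1
  have hbase : Kup ^ α ≤ Smolyak.rateBase D K α Kup (E + B / D) := by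
    refine le_mul_of_one_le_right (by positivity) ?_
    refine one_le_mul_of_one_le_of_one_le (by linarith)
      (one_le_mul_of_one_le_of_one_le (le_add_of_nonneg_right (by positivity))
        (le_add_of_nonneg_right (by positivity)))
  have hKupα : 0 < Kup ^ α := by positivity
  refine ⟨C * (K / (K - 1)) ^ α, Smolyak.rateBase D K α Kup (E + B / D), by positivity,
    hKupα.trans_le hbase, ?_⟩
  intro d F _ _ _ _ G _ _ _ _ Ω _ P _ S Λ U hErr hCost L N hL hN
  have hN1 := Smolyak.ranCard_smolyakInfo_le (by linarith) hK hCost L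
  rw [← hN] at hN1
  have hNtop : N ≠ ⊤ := (hN1.trans_lt ENNReal.ofReal_lt_top).ne
  have hNle : d ≠ 0 → N.toReal
      ≤ Kup ^ d * (K / (K - 1) * (L - 1).choose (d - 1) * K ^ L) := fun hd => by
    obtain ⟨k, rfl⟩ : ∃ k, d = k + 1 := ⟨d - 1, by omega⟩
    refine ENNReal.toReal_le_of_le_ofReal (by positivity) (hN1.trans ?_)
    rw [← Finset.mul_sum]
    gcongr
    exact Smolyak.sum_levels_pow_le hK k L
  refine ⟨hNtop, fun hd => ?_, fun hd hN' => ?_⟩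
  · refine (Smolyak.err_smolyak_le hB.le hC.le hD0 hE.le hErr (by omega) hL).trans
      (ENNReal.ofReal_le_ofReal ?_)
    have hN0 : 0 < N.toReal := by
      refine ENNReal.toReal_pos ?_ hNtop
      rw [hN]
      exact Smolyak.ranCard_smolyakInfo_ne_zero (by linarith) hK hCost hd hL
    have h1 := hNle (by omega)
    subst hd
    have h2 := Smolyak.pow_le_of_cost_le hD hK hα hN0 (L := L) (M := Kup * (K / (K - 1)))
      (by simpa [mul_assoc] using h1)
    rw [Real.mul_rpow (by positivity) (by positivity)] at h2
    calc C * D ^ L * (L - 1).choose (1 - 1) * (E + B / D) ^ (1 - 1) = C * D ^ L := by simp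
      _ ≤ C * (Kup ^ α * (K / (K - 1)) ^ α * N.toReal ^ (-α)) := by gcongr
      _ = C * (K / (K - 1)) ^ α * Kup ^ α * N.toReal ^ (-α) := by ring
      _ ≤ _ := by gcongr
  · refine (Smolyak.err_smolyak_le hB.le hC.le hD0 hE.le hErr (by omega) hL).trans
      (ENNReal.ofReal_le_ofReal ?_)
    have h1 := hNle (by omega)
    have hN'' : 1 ≤ N.toReal := by simpa using ENNReal.toReal_mono hNtop hN'
    obtain ⟨k, rfl⟩ : ∃ k, d = k + 1 := ⟨d - 1, by omega⟩
    obtain ⟨m, rfl⟩ : ∃ m, L = m + 1 := ⟨L - 1, by omega⟩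
    have h2 := Smolyak.error_le_of_cost_le hD hK hα hC hKup1 hH hN'' (by omega) (by omega) h1
    simpa only [Nat.add_sub_cancel, Nat.cast_add, Nat.cast_one, add_sub_cancel_right] using h2
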